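/- Let $\delta\in[0,1)$ and $C\ge 1$. There is a constant $K>0$, depending only on $\delta$ and $C$, such that the following holds. For every $m\ge1$ let $X^{(m)}_1,\dots,X^{(m)}_m$ be independent (not necessarily identically distributed) real random variables with mean zero and finite variance, defined on a probability space that may depend on $m$, and put $$\sigma_m:=\sqrt{\frac1m\sum_{i=1}^m\mathrm{Var}\big(X^{(m)}_i\big)} .$$ Suppose that for every $m\ge1$ we have $\sigma_m\ge1$ and $$\mathbb E\big[|X^{(m)}_i|^j\big]\le j!\,(C\sigma_m)^{(1+\delta)j}\qquad\text{for all } i=1,\dots,m \text{ and all integers } j\ge2$$ (in particular these moments are finite). Let $F_m$ be the distribution function of $(X^{(m)}_1+\dots+X^{(m)}_m)/(\sigma_m\sqrt m)$ and let $\Phi$ be the distribution function of the standard Gaussian distribution. Assume that $\sigma_m^\delta=o(m^{1/6})$ as $m\to\infty$. Then for every real sequence $(x_m)_{m\ge1}$ with $x_m\to\infty$ and $x_m=o\big(m^{1/6}/\sigma_m^{\delta}\big)$ as $m\to\infty$ we have $$1-F_m(x_m)=(1+r_m)\,\big[1-\Phi(x_m)\big],\qquad |r_m|\le K\,\sigma_m^{3\delta}\,\frac{x_m^3}{\sqrt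 m},$$ for all sufficiently large $m$. -/

import Mathlib

open MeasureTheory ProbabilityTheory Filter Asymptotics

/-- The square root of the averaged variance of the row `X 0, …, X (m - 1)`. -/
noncomputable def avgSigma {Ω : Type*} [MeasurableSpace Ω] (P : Measure Ω) {m : ℕ}
    (X : Fin m → Ω → ℝ) : ℝ :=
  Real.sqrt ((∑ i, variance (X i) P) / (m : ℝ))

/-- The normalised row sum `(X 0 + ⋯ + X (m - 1)) / (σ √m)`. -/
noncomputable def normalizedSum {Ω : Type*} [MeasurableSpace Ω] (P : Measure Ω) {m : ℕ}
    (X : Fin m → Ω → ℝ) (ω : Ω) : ℝ :=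
  (∑ i, X i ω) / (avgSigma P X * Real.sqrt (m : ℝ))

/-- The distribution function of the normalised row sum. -/
noncomputable def sumCDF {Ω : Type*} [MeasurableSpace Ω] (P : Measure Ω) {m : ℕ}
    (X : Fin m → Ω → ℝ) (x : ℝ) : ℝ :=
  cdf (P.map (normalizedSum P X)) x

/-- The distribution function `Φ` of the standard Gaussian distribution. -/
noncomputable def stdGaussianCDF (x : ℝ) : ℝ :=
  cdf (gaussianReal 0 1) x

/-!
The proof combines Cramér's change of measure with a Berry–Esseen theorem.

Write `Y i = X i / (σ √m)` for the normalised summands and `S` for their sum. The moment hypothesis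
says `E |Y i|^j ≤ j! h^j` with `h = (C σ)^{1+δ} / (σ √m)`, so everything is governed by
`L = m h³ = C^{3(1+δ)} σ^{3δ} / √m`, and the claim is that `P(S > x)` differs from the Gaussian tail
by a relative error of order `L x³`.

Tilting each law by `e^{xy}` (`HasFactorialMoments.tilted`, `pi_tilted`) gives
`P(S > x) = E e^{xS} · e^{-x²} · E_x [e^{-x(S-x)}; S > x]`, and for a standard Gaussian `N`,
`P(N > x) = e^{-x²/2} · E [e^{-xN}; N > 0]`. Expanding the cumulant generating function to third
order yields `E e^{xS} = e^{x²/2 + O(L x³)}`. Under the tilted law `S - x` is a sum of independent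
variables with mean `O(L x²)`, variance `1 + O(L x)` and total third absolute moment `O(L)`, so by
Berry–Esseen its distribution function is within `O(L x²)` of `Φ` (`abs_pi_tilted_sub_le`). By the
layer-cake formula the two remaining expectations differ by `O(L x²)`, whereas the Gaussian one is
at least of order `1 / x`; this is a relative error `O(L x³)` (`abs_pi_tail_sub_le`).

The Berry–Esseen theorem (`berryEsseen`) is proved by Stein's method: the solution of Stein's
equation for the indicator of a half-line is Lipschitz with a derivative that jumps only at the
endpoint (`abs_steinDeriv_add_sub_le`, `abs_steinSol_add_sub_le`), and the probability that a
leave-one-out sum falls near that endpoint is controlled by the Chen–Shao concentration inequality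
(`measureReal_sum_mem_Icc_le`).
-/

/-! ### Gaussian tails and the Mills ratio -/

/-- The upper tail `1 - Φ(w)` of the standard Gaussian distribution. -/
noncomputable def gaussianTail (w : ℝ) : ℝ := (gaussianReal 0 1).real (Set.Ioi w)

lemma gaussianPDFReal_zero_one (w : ℝ) :
    gaussianPDFReal 0 1 w = (√(2 * Real.pi))⁻¹ * Real.exp (-w ^ 2 / 2) := by
  simp [gaussianPDFReal]

lemma sqrt_two_pi_pos : 0 < √(2 * Real.pi) := by positivity

lemma sqrt_two_pi_le_three : √(2 * Real.pi) ≤ 3 := by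
  rw [Real.sqrt_le_left (by norm_num)]
  nlinarith [Real.pi_lt_d2]

lemma gaussianTail_nonneg (w : ℝ) : 0 ≤ gaussianTail w := measureReal_nonneg

lemma gaussianTail_le_one (w : ℝ) : gaussianTail w ≤ 1 := measureReal_le_one

lemma gaussianTail_antitone : Antitone gaussianTail := fun _ _ h =>
  measureReal_mono (Set.Ioi_subset_Ioi h)

lemma gaussianReal_real_Iic_eq (w : ℝ) : (gaussianReal 0 1).real (Set.Iic w) = 1 - gaussianTail w := by
  rw [gaussianTail, ← Set.compl_Iic, probReal_compl_eq_one_sub measurableSet_Iic]; ring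

lemma stdGaussianCDF_eq (w : ℝ) : stdGaussianCDF w = 1 - gaussianTail w := by
  rw [stdGaussianCDF, cdf_eq_real, gaussianReal_real_Iic_eq]

lemma gaussianTail_eq_integral (w : ℝ) :
    gaussianTail w = ∫ t in Set.Ioi w, gaussianPDFReal 0 1 t := by
  rw [gaussianTail, measureReal_def, gaussianReal_apply_eq_integral _ one_ne_zero,
    ENNReal.toReal_ofReal]
  exact setIntegral_nonneg measurableSet_Ioi fun t _ => gaussianPDFReal_nonneg _ _ _

lemma gaussianTail_neg (w : ℝ) : gaussianTail (-w) = 1 - gaussianTail w := by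
  have h : (gaussianReal 0 1).map (fun x => -x) = gaussianReal 0 1 := by
    rw [gaussianReal_map_neg]; simp
  have : NullSingletonClass (gaussianReal 0 1) := nullSingletonClass_gaussianReal one_ne_zero
  rw [← gaussianReal_real_Iic_eq, gaussianTail]
  conv_lhs => rw [← h]
  rw [map_measureReal_apply measurable_neg measurableSet_Ioi]
  have : (fun x : ℝ => -x) ⁻¹' Set.Ioi (-w) = Set.Iio w := by ext; simp
  rw [this]
  exact measureReal_congr Iio_ae_eq_Iic

lemma continuous_gaussianPDFReal : Continuous (gaussianPDFReal 0 1) := by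
  have : gaussianPDFReal 0 1 = fun w => (√(2 * Real.pi))⁻¹ * Real.exp (-w ^ 2 / 2) :=
    funext gaussianPDFReal_zero_one
  rw [this]; fun_prop

lemma gaussianTail_sub (a b : ℝ) :
    gaussianTail a - gaussianTail b = ∫ t in a..b, gaussianPDFReal 0 1 t := by
  have hi : ∀ c, IntegrableOn (gaussianPDFReal 0 1) (Set.Ioi c) := fun c =>
    (integrable_gaussianPDFReal 0 1).integrableOn
  rw [gaussianTail_eq_integral, gaussianTail_eq_integral,
    intervalIntegral.integral_Ioi_sub_Ioi' (hi a) (hi b)]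

lemma hasDerivAt_gaussianTail (w : ℝ) :
    HasDerivAt gaussianTail (-gaussianPDFReal 0 1 w) w := by
  have h1 : HasDerivAt (fun u => ∫ t in (0 : ℝ)..u, gaussianPDFReal 0 1 t)
      (gaussianPDFReal 0 1 w) w :=
    intervalIntegral.integral_hasDerivAt_right
      (continuous_gaussianPDFReal.intervalIntegrable _ _)
      continuous_gaussianPDFReal.aestronglyMeasurable.stronglyMeasurableAtFilter
      continuous_gaussianPDFReal.continuousAt
  have h2 : gaussianTail = fun u => gaussianTail 0 - ∫ t in (0 : ℝ)..u, gaussianPDFReal 0 1 t := by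
    ext u; rw [← gaussianTail_sub]; ring
  rw [h2]
  simpa using h1.const_sub (gaussianTail 0)

lemma hasDerivAt_gaussianPDFReal (w : ℝ) :
    HasDerivAt (gaussianPDFReal 0 1) (-(w * gaussianPDFReal 0 1 w)) w := by
  have : gaussianPDFReal 0 1 = fun w => (√(2 * Real.pi))⁻¹ * Real.exp (-w ^ 2 / 2) :=
    funext gaussianPDFReal_zero_one
  rw [this]
  have h : HasDerivAt (fun w : ℝ => -w ^ 2 / 2) (-w) w := by
    have := ((hasDerivAt_pow 2 w).neg).div_const 2
    convert! this using 1; norm_num; ring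
  convert! (h.exp.const_mul (√(2 * Real.pi))⁻¹) using 1
  ring

/-- The Mills ratio bound `w (1 - Φ(w)) ≤ φ(w)`; the right-hand side is `∫_w^∞ t φ(t) dt`. -/
lemma mul_gaussianTail_le {w : ℝ} (hw : 0 ≤ w) :
    w * gaussianTail w ≤ gaussianPDFReal 0 1 w := by
  have htend : Tendsto (fun t => -gaussianPDFReal 0 1 t) atTop (nhds 0) := by
    have : Tendsto (fun t : ℝ => Real.exp (-t ^ 2 / 2)) atTop (nhds 0) := by
      apply Real.tendsto_exp_atBot.comp
      have := (tendsto_pow_atTop (α := ℝ) (n := 2) (by norm_num)).atTop_div_const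
        (show (0 : ℝ) < 2 by norm_num)
      have := tendsto_neg_atTop_atBot.comp this
      refine this.congr fun t => ?_
      simp only [Function.comp]; ring
    have h2 := (this.const_mul (√(2 * Real.pi))⁻¹).neg
    simp only [mul_zero, neg_zero] at h2
    exact h2.congr fun t => by rw [gaussianPDFReal_zero_one]
  have hd : ∀ t ∈ Set.Ici w, HasDerivAt (fun t => -gaussianPDFReal 0 1 t)
      (t * gaussianPDFReal 0 1 t) t := fun t _ => by
    exact (hasDerivAt_gaussianPDFReal t).neg.congr_deriv (neg_neg _)
  have hpos : ∀ t ∈ Set.Ioi w, 0 ≤ t * gaussianPDFReal 0 1 t := fun t ht =>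
    mul_nonneg (hw.trans (le_of_lt ht)) (gaussianPDFReal_nonneg _ _ _)
  have hint := integrableOn_Ioi_deriv_of_nonneg' hd hpos htend
  have heq := integral_Ioi_of_hasDerivAt_of_nonneg' hd hpos htend
  rw [gaussianTail_eq_integral, ← integral_const_mul]
  calc ∫ t in Set.Ioi w, w * gaussianPDFReal 0 1 t
      ≤ ∫ t in Set.Ioi w, t * gaussianPDFReal 0 1 t := by
        refine setIntegral_mono_on ((integrable_gaussianPDFReal 0 1).integrableOn.const_mul w)
          hint measurableSet_Ioi fun t ht => ?_
        exact mul_le_mul_of_nonneg_right (le_of_lt ht) (gaussianPDFReal_nonneg _ _ _)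
    _ = gaussianPDFReal 0 1 w := by rw [heq]; ring

lemma gaussianTail_le_exp {w : ℝ} (hw : 0 ≤ w) : gaussianTail w ≤ Real.exp (-w ^ 2 / 2) := by
  have h := measure_ge_le_exp_mul_mgf (μ := gaussianReal 0 1) (X := id) w hw
    (by simpa using integrable_exp_mul_gaussianReal w)
  rw [mgf_id_gaussianReal] at h
  calc gaussianTail w ≤ (gaussianReal 0 1).real {x | w ≤ id x} :=
        measureReal_mono fun x (hx : w < x) => hx.le
    _ ≤ _ := h
    _ = Real.exp (-w ^ 2 / 2) := by
        rw [← Real.exp_add]; congr 1; simp; ring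

/-- Gaussian tails are at least of order `exp (-x² / 2) / x`. -/
lemma le_mul_gaussianTail {x : ℝ} (hx : 1 ≤ x) :
    1 / (20 * x) ≤ Real.exp (x ^ 2 / 2) * gaussianTail x := by
  have hx0 : 0 < x := by linarith
  have h1 : gaussianTail x - gaussianTail (x + 1 / x) = ∫ t in x..(x + 1 / x),
      gaussianPDFReal 0 1 t := gaussianTail_sub _ _
  have hle : x ≤ x + 1 / x := by have : 0 < 1 / x := by positivity
                                 linarith
  -- on `[x, x + 1/x]` the exponent exceeds `x² / 2` by at most `3 / 2`
  have h2 : ∫ t in x..(x + 1 / x), (3⁻¹ * Real.exp (-x ^ 2 / 2 - 3 / 2)) ≤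
      ∫ t in x..(x + 1 / x), gaussianPDFReal 0 1 t := by
    refine intervalIntegral.integral_mono_on hle (by simp)
      (continuous_gaussianPDFReal.intervalIntegrable _ _) fun t ht => ?_
    rw [gaussianPDFReal_zero_one]
    refine mul_le_mul ?_ ?_ (by positivity) (by positivity)
    · exact inv_anti₀ sqrt_two_pi_pos sqrt_two_pi_le_three
    · apply Real.exp_le_exp.2
      have h3 : t ^ 2 ≤ (x + 1 / x) ^ 2 := by
        apply pow_le_pow_left₀ (by linarith [ht.1]) ht.2
      have h4 : (x + 1 / x) ^ 2 = x ^ 2 + 2 + (1 / x) ^ 2 := by field_simp; ring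
      have h5 : (1 / x) ^ 2 ≤ 1 := by
        apply pow_le_one₀ (by positivity)
        rw [div_le_one hx0]; exact hx
      linarith
  rw [intervalIntegral.integral_const, smul_eq_mul] at h2
  have h6 : (1 / x) * (3⁻¹ * Real.exp (-x ^ 2 / 2 - 3 / 2)) ≤ gaussianTail x := by
    have := gaussianTail_nonneg (x + 1 / x)
    have h7 : x + 1 / x - x = 1 / x := by ring
    rw [h7] at h2
    linarith
  have h8 : Real.exp (x ^ 2 / 2) * ((1 / x) * (3⁻¹ * Real.exp (-x ^ 2 / 2 - 3 / 2))) =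
      (1 / x) * 3⁻¹ * Real.exp (-(3 / 2)) := by
    have : Real.exp (-(3 / 2)) = Real.exp (x ^ 2 / 2) * Real.exp (-x ^ 2 / 2 - 3 / 2) := by
      rw [← Real.exp_add]; congr 1; ring
    rw [this]; ring
  have h9 : (3 / 20 : ℝ) ≤ Real.exp (-(3 / 2)) := by
    rw [Real.exp_neg, show (3 / 20 : ℝ) = (20 / 3)⁻¹ by norm_num]
    apply inv_anti₀ (Real.exp_pos _)
    have h10 : Real.exp (3 / 2) ^ 2 = Real.exp 1 ^ 3 := by
      rw [← Real.exp_nat_mul, ← Real.exp_nat_mul]; norm_num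
    have h11 : Real.exp 1 ^ 3 ≤ 2.7182818286 ^ 3 :=
      pow_le_pow_left₀ (Real.exp_pos _).le Real.exp_one_lt_d9.le 3
    nlinarith [Real.exp_pos (3 / 2)]
  calc 1 / (20 * x) = (1 / x) * 3⁻¹ * (3 / 20) := by field_simp
    _ ≤ (1 / x) * 3⁻¹ * Real.exp (-(3 / 2)) := by gcongr
    _ = _ := h8.symm
    _ ≤ _ := by gcongr

/-- The Mills ratio of the standard Gaussian, up to the factor `√(2π)`. -/
noncomputable def millsRatio (w : ℝ) : ℝ := Real.exp (w ^ 2 / 2) * gaussianTail w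

lemma millsRatio_nonneg (w : ℝ) : 0 ≤ millsRatio w :=
  mul_nonneg (Real.exp_pos _).le (gaussianTail_nonneg _)

lemma millsRatio_le_one {w : ℝ} (hw : 0 ≤ w) : millsRatio w ≤ 1 := by
  calc millsRatio w ≤ Real.exp (w ^ 2 / 2) * Real.exp (-w ^ 2 / 2) :=
        mul_le_mul_of_nonneg_left (gaussianTail_le_exp hw) (Real.exp_pos _).le
    _ = 1 := by rw [← Real.exp_add, ← Real.exp_zero]; congr 1; ring

lemma mul_millsRatio_le {w : ℝ} (hw : 0 ≤ w) : √(2 * Real.pi) * (w * millsRatio w) ≤ 1 := by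
  have h := mul_gaussianTail_le hw
  rw [gaussianPDFReal_zero_one] at h
  have e : Real.exp (w ^ 2 / 2) * Real.exp (-w ^ 2 / 2) = 1 := by
    rw [← Real.exp_add, ← Real.exp_zero]; congr 1; ring
  calc √(2 * Real.pi) * (w * millsRatio w)
      = √(2 * Real.pi) * Real.exp (w ^ 2 / 2) * (w * gaussianTail w) := by rw [millsRatio]; ring
    _ ≤ √(2 * Real.pi) * Real.exp (w ^ 2 / 2) *
        ((√(2 * Real.pi))⁻¹ * Real.exp (-w ^ 2 / 2)) := by gcongr
    _ = (√(2 * Real.pi) * (√(2 * Real.pi))⁻¹) *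
        (Real.exp (w ^ 2 / 2) * Real.exp (-w ^ 2 / 2)) := by ring
    _ = 1 := by rw [e, mul_inv_cancel₀ sqrt_two_pi_pos.ne', one_mul]

lemma hasDerivAt_millsRatio (w : ℝ) :
    HasDerivAt millsRatio (w * millsRatio w - (√(2 * Real.pi))⁻¹) w := by
  have h : HasDerivAt (fun w : ℝ => w ^ 2 / 2) w w := by
    have := (hasDerivAt_pow 2 w).div_const 2
    convert! this using 1; norm_num
  have := h.exp.mul (hasDerivAt_gaussianTail w)
  refine this.congr_deriv ?_
  have e : Real.exp (w ^ 2 / 2) * Real.exp (-w ^ 2 / 2) = 1 := by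
    rw [← Real.exp_add, ← Real.exp_zero]; congr 1; ring
  rw [gaussianPDFReal_zero_one, millsRatio]
  linear_combination -(√(2 * Real.pi))⁻¹ * e

lemma gaussianTail_mul_millsRatio_mem {u v : ℝ} (huv : u ≤ v) :
    gaussianTail v * millsRatio (-u) ≤ 1 ∧
      √(2 * Real.pi) * (|u| * (gaussianTail v * millsRatio (-u))) ≤ 1 := by
  rcases le_total u 0 with hu | hu
  · have hm := millsRatio_nonneg (-u)
    have hle : gaussianTail v * millsRatio (-u) ≤ millsRatio (-u) :=
      mul_le_of_le_one_left hm (gaussianTail_le_one _)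
    refine ⟨hle.trans (millsRatio_le_one (by linarith)), ?_⟩
    rw [abs_of_nonpos hu]
    refine le_trans ?_ (mul_millsRatio_le (w := -u) (by linarith))
    gcongr
    linarith
  · have hle : gaussianTail v * millsRatio (-u) ≤ millsRatio u := by
      calc gaussianTail v * millsRatio (-u) ≤ gaussianTail u * millsRatio (-u) :=
            mul_le_mul_of_nonneg_right (gaussianTail_antitone huv) (millsRatio_nonneg _)
        _ = gaussianTail (-u) * millsRatio u := by simp only [millsRatio, neg_sq]; ring
        _ ≤ millsRatio u := mul_le_of_le_one_left (millsRatio_nonneg _) (gaussianTail_le_one _)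
    refine ⟨hle.trans (millsRatio_le_one hu), ?_⟩
    rw [abs_of_nonneg hu]
    refine le_trans ?_ (mul_millsRatio_le hu)
    gcongr

/-! ### Stein's equation for a half-line -/

/-- The bounded solution `f` of Stein's equation `f'(w) - w f(w) = 1_{w ≤ z} - Φ(z)`. -/
noncomputable def steinSol (z w : ℝ) : ℝ :=
  if w ≤ z then √(2 * Real.pi) * (gaussianTail z * millsRatio (-w))
  else √(2 * Real.pi) * (gaussianTail (-z) * millsRatio w)

/-- The derivative of `steinSol z` away from `z`, read off Stein's equation; at `w = z` this is
the left derivative. -/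
noncomputable def steinDeriv (z w : ℝ) : ℝ :=
  w * steinSol z w + (Set.Iic z).indicator 1 w - (1 - gaussianTail z)

lemma steinSol_of_ge {z w : ℝ} (h : z ≤ w) :
    steinSol z w = √(2 * Real.pi) * (gaussianTail (-z) * millsRatio w) := by
  unfold steinSol
  split_ifs with h'
  · obtain rfl := le_antisymm h h'
    simp only [millsRatio, neg_sq]; ring
  · rfl

lemma steinSol_of_le {z w : ℝ} (h : w ≤ z) :
    steinSol z w = √(2 * Real.pi) * (gaussianTail z * millsRatio (-w)) := if_pos h

lemma steinSol_bounds (z w : ℝ) : |steinSol z w| ≤ 3 ∧ |w * steinSol z w| ≤ 1 := by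
  have hs := sqrt_two_pi_le_three
  have hs0 := sqrt_two_pi_pos
  have key : ∀ u v : ℝ, u ≤ v →
      |√(2 * Real.pi) * (gaussianTail v * millsRatio (-u))| ≤ 3 ∧
      |u * (√(2 * Real.pi) * (gaussianTail v * millsRatio (-u)))| ≤ 1 := by
    intro u v huv
    obtain ⟨h1, h2⟩ := gaussianTail_mul_millsRatio_mem huv
    have h0 : 0 ≤ gaussianTail v * millsRatio (-u) :=
      mul_nonneg (gaussianTail_nonneg _) (millsRatio_nonneg _)
    constructor
    · rw [abs_of_nonneg (by positivity)]; nlinarith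
    · rw [abs_mul, abs_of_nonneg (mul_nonneg hs0.le h0)]; linarith
  rcases le_total w z with h | h
  · rw [steinSol_of_le h]; exact key w z h
  · rw [steinSol_of_ge h]
    simpa using key (-w) (-z) (by linarith)

lemma abs_steinDeriv_le (z w : ℝ) : |steinDeriv z w| ≤ 2 := by
  have h1 := abs_le.1 (steinSol_bounds z w).2
  have h2 := gaussianTail_nonneg z
  have h3 := gaussianTail_le_one z
  rw [steinDeriv, abs_le]
  by_cases h : w ≤ z
  · simp only [Set.indicator, Set.mem_Iic, h, if_true, Pi.one_apply]
    constructor <;> linarith [h1.1, h1.2]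
  · simp only [Set.indicator, Set.mem_Iic, h, if_false]
    constructor <;> linarith [h1.1, h1.2]

lemma hasDerivAt_steinSol_left {z w : ℝ} (h : w ≤ z) :
    HasDerivAt (fun w => √(2 * Real.pi) * (gaussianTail z * millsRatio (-w)))
      (steinDeriv z w) w := by
  have h1 := ((hasDerivAt_millsRatio (-w)).comp w (hasDerivAt_neg w)).const_mul (gaussianTail z)
  have h2 := h1.const_mul √(2 * Real.pi)
  refine h2.congr_deriv ?_
  have e := mul_inv_cancel₀ sqrt_two_pi_pos.ne'
  rw [steinDeriv, steinSol_of_le h]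
  simp only [Set.indicator, Set.mem_Iic, h, if_true, Pi.one_apply]
  linear_combination gaussianTail z * e

lemma hasDerivAt_steinSol_right {z w : ℝ} (h : z < w) :
    HasDerivAt (fun w => √(2 * Real.pi) * (gaussianTail (-z) * millsRatio w))
      (steinDeriv z w) w := by
  have h1 := (hasDerivAt_millsRatio w).const_mul (gaussianTail (-z))
  have h2 := h1.const_mul √(2 * Real.pi)
  refine h2.congr_deriv ?_
  have e := mul_inv_cancel₀ sqrt_two_pi_pos.ne'
  rw [steinDeriv, steinSol_of_ge h.le]
  simp only [Set.indicator, Set.mem_Iic, not_le.2 h, if_false]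
  linear_combination -gaussianTail (-z) * e - gaussianTail_neg z

lemma continuous_steinSol (z : ℝ) : Continuous (steinSol z) := by
  unfold steinSol
  have hc : Continuous millsRatio :=
    continuous_iff_continuousAt.2 fun w => (hasDerivAt_millsRatio w).continuousAt
  refine Continuous.if_le (by fun_prop) (by fun_prop) continuous_id continuous_const ?_
  intro x hx
  change x = z at hx
  subst hx
  simp only [millsRatio, neg_sq]; ring

lemma hasDerivAt_steinSol {z w : ℝ} (h : w ≠ z) :
    HasDerivAt (steinSol z) (steinDeriv z w) w := by
  rcases lt_or_gt_of_ne h with h | h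
  · refine (hasDerivAt_steinSol_left h.le).congr_of_eventuallyEq ?_
    filter_upwards [Iio_mem_nhds h] with t ht
    exact steinSol_of_le (le_of_lt ht)
  · refine (hasDerivAt_steinSol_right h).congr_of_eventuallyEq ?_
    filter_upwards [Ioi_mem_nhds h] with t ht
    exact steinSol_of_ge (le_of_lt ht)

lemma measurable_steinDeriv (z : ℝ) : Measurable (steinDeriv z) := by
  unfold steinDeriv
  refine Measurable.sub (Measurable.add ?_ ?_) measurable_const
  · exact measurable_id.mul (continuous_steinSol z).measurable
  · exact measurable_one.indicator measurableSet_Iic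

/-- The mean value theorem for `steinSol z` on an interval whose interior avoids the kink `z`. -/
lemma exists_steinSol_sub_eq {z a b : ℝ} (hab : a < b) (hz : z ∉ Set.Ioo a b) :
    ∃ c ∈ Set.Ioo a b, steinSol z b - steinSol z a = steinDeriv z c * (b - a) := by
  obtain ⟨c, hc, h⟩ := exists_hasDerivAt_eq_slope (steinSol z) (steinDeriv z) hab
    (continuous_steinSol z).continuousOn
    (fun x hx => hasDerivAt_steinSol fun h => hz (h ▸ hx))
  refine ⟨c, hc, ?_⟩
  rw [h, div_mul_cancel₀ _ (by linarith)]

lemma abs_steinSol_sub_le (z a b : ℝ) : |steinSol z b - steinSol z a| ≤ 2 * |b - a| := by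
  have key : ∀ a b : ℝ, a < b → z ∉ Set.Ioo a b →
      |steinSol z b - steinSol z a| ≤ 2 * (b - a) := by
    intro a b hab hz
    obtain ⟨c, -, h⟩ := exists_steinSol_sub_eq hab hz
    rw [h, abs_mul, abs_of_pos (sub_pos.2 hab)]
    exact mul_le_mul_of_nonneg_right (abs_steinDeriv_le z c) (by linarith)
  have key2 : ∀ a b : ℝ, a < b → |steinSol z b - steinSol z a| ≤ 2 * (b - a) := by
    intro a b hab
    by_cases hz : z ∈ Set.Ioo a b
    · have h1 := key a z hz.1 (by simp)
      have h2 := key z b hz.2 (by simp)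
      have := abs_add_le (steinSol z b - steinSol z z) (steinSol z z - steinSol z a)
      rw [sub_add_sub_cancel] at this
      linarith
    · exact key a b hab hz
  rcases lt_trichotomy a b with h | h | h
  · rw [abs_of_pos (sub_pos.2 h)]; exact key2 a b h
  · subst h; simp
  · rw [abs_sub_comm, abs_sub_comm b a, abs_of_pos (sub_pos.2 h)]; exact key2 b a h

/-- The remainder controlling the increments of the Stein solution: a smooth part plus the
contribution of the jump of `steinDeriv z` at `z`. -/
noncomputable def steinErr (z u w : ℝ) : ℝ :=
  3 * |u| * (1 + |w|) + 4 * {p : ℝ × ℝ | |p.2 - z| ≤ |p.1|}.indicator 1 (u, w)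

lemma steinErr_of_mem {z u w : ℝ} (h : |w - z| ≤ |u|) :
    steinErr z u w = 3 * |u| * (1 + |w|) + 4 := by
  simp [steinErr, h]

lemma steinErr_of_notMem {z u w : ℝ} (h : ¬ |w - z| ≤ |u|) :
    steinErr z u w = 3 * |u| * (1 + |w|) := by
  simp [steinErr, h]

lemma abs_mul_steinSol_sub_le (z w v : ℝ) :
    |v * steinSol z v - w * steinSol z w| ≤ 3 * |v - w| * (1 + |w|) := by
  have h1 := abs_steinSol_sub_le z w v
  have h2 := (steinSol_bounds z v).1
  have : v * steinSol z v - w * steinSol z w =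
      (v - w) * steinSol z v + w * (steinSol z v - steinSol z w) := by ring
  rw [this]
  refine (abs_add_le _ _).trans ?_
  rw [abs_mul, abs_mul]
  nlinarith [abs_nonneg (v - w), abs_nonneg w, mul_nonneg (abs_nonneg (v - w)) (abs_nonneg w)]

lemma abs_steinDeriv_add_sub_le (z u w : ℝ) :
    |steinDeriv z (w + u) - steinDeriv z w| ≤ steinErr z u w := by
  by_cases h : |w - z| ≤ |u|
  · rw [steinErr_of_mem h]
    have h1 := abs_steinDeriv_le z (w + u)
    have h2 := abs_steinDeriv_le z w
    have := abs_sub (steinDeriv z (w + u)) (steinDeriv z w)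
    have : 0 ≤ 3 * |u| * (1 + |w|) := by positivity
    linarith
  · rw [steinErr_of_notMem h]
    have hi : (Set.Iic z).indicator (1 : ℝ → ℝ) (w + u) = (Set.Iic z).indicator 1 w := by
      have : w + u ≤ z ↔ w ≤ z := by
        rcases abs_cases (w - z) with h1 | h1 <;> rcases abs_cases u with h2 | h2 <;>
          constructor <;> intro _ <;> linarith
      by_cases hw : w ≤ z
      · simp [Set.indicator, hw, this.2 hw]
      · have h' : ¬ (w + u ≤ z) := fun h'' => hw (this.1 h'')
        simp only [Set.indicator, Set.mem_Iic, hw, h', if_false]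
    have := abs_mul_steinSol_sub_le z w (w + u)
    simp only [add_sub_cancel_left] at this
    rw [steinDeriv, steinDeriv, hi]
    convert! this using 2
    ring

lemma abs_steinSol_add_sub_le (z u w : ℝ) :
    |steinSol z (w + u) - steinSol z w - u * steinDeriv z w| ≤ |u| * steinErr z u w := by
  by_cases h : |w - z| ≤ |u|
  · rw [steinErr_of_mem h]
    have h1 := abs_steinSol_sub_le z w (w + u)
    rw [add_sub_cancel_left] at h1
    have h2 := abs_steinDeriv_le z w
    have h3 := abs_sub (steinSol z (w + u) - steinSol z w) (u * steinDeriv z w)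
    rw [abs_mul] at h3
    have : 0 ≤ |u| * (3 * |u| * (1 + |w|)) := by positivity
    nlinarith [abs_nonneg u]
  · have hu : u ≠ 0 ∨ u = 0 := (em _).symm
    rcases hu with hu | rfl
    swap
    · simp
    -- the segment from `w` to `w + u` avoids `z`, so the mean value theorem applies
    obtain ⟨v, hv, e⟩ : ∃ v, |v| ≤ |u| ∧
        steinSol z (w + u) - steinSol z w = u * steinDeriv z (w + v) := by
      rcases lt_or_gt_of_ne hu with hu | hu
      · obtain ⟨c, hc, e⟩ := exists_steinSol_sub_eq (z := z) (a := w + u) (b := w) (by linarith)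
          (fun hz => h (by rw [abs_of_neg hu, abs_of_pos (by linarith [hz.2])]; linarith [hz.1]))
        refine ⟨c - w, ?_, ?_⟩
        · rw [abs_of_neg hu, abs_of_neg (by linarith [hc.2])]; linarith [hc.1]
        · rw [add_sub_cancel]; linarith
      · obtain ⟨c, hc, e⟩ := exists_steinSol_sub_eq (z := z) (a := w) (b := w + u) (by linarith)
          (fun hz => h (by rw [abs_of_pos hu, abs_of_neg (by linarith [hz.1])]; linarith [hz.2]))
        refine ⟨c - w, ?_, ?_⟩
        · rw [abs_of_pos hu, abs_of_pos (by linarith [hc.1])]; linarith [hc.2]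
        · rw [add_sub_cancel]; linarith
    rw [e, ← mul_sub, abs_mul]
    refine mul_le_mul_of_nonneg_left ?_ (abs_nonneg u)
    refine (abs_steinDeriv_add_sub_le z v w).trans ?_
    rw [steinErr_of_notMem h, steinErr_of_notMem (fun h' => h (h'.trans hv))]
    gcongr

/-! ### The concentration inequality -/

lemma MeasureTheory.MemLp.integrable_abs_pow_three {Ω : Type*} [MeasurableSpace Ω] {μ : Measure Ω}
    [IsProbabilityMeasure μ] {X : Ω → ℝ} (h : MemLp X 3 μ) :
    Integrable (fun ω => |X ω| ^ 3) μ := by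
  simpa using h.integrable_norm_pow (p := 3) (by norm_num)

lemma integral_sq_sum_of_iIndepFun {ι Ω : Type*} [MeasurableSpace Ω] {μ : Measure Ω}
    [IsProbabilityMeasure μ] {ξ : ι → Ω → ℝ} (s : Finset ι) (hind : iIndepFun ξ μ)
    (h2 : ∀ i, MemLp (ξ i) 2 μ) (h0 : ∀ i, ∫ ω, ξ i ω ∂μ = 0) :
    ∫ ω, (∑ i ∈ s, ξ i ω) ^ 2 ∂μ = ∑ i ∈ s, ∫ ω, ξ i ω ^ 2 ∂μ := by
  have hv := IndepFun.variance_sum (s := s) (fun i _ => h2 i)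
    (fun i _ j _ hij => hind.indepFun hij)
  have hi : ∀ i, Integrable (ξ i) μ := fun i => (h2 i).integrable one_le_two
  rw [variance_of_integral_eq_zero] at hv
  · simp only [Finset.sum_apply] at hv
    rw [hv]
    exact Finset.sum_congr rfl fun i _ =>
      variance_of_integral_eq_zero (hi i).aemeasurable (h0 i)
  · exact (integrable_finsetSum' s fun i _ => hi i).aemeasurable
  · simp only [Finset.sum_apply]
    rw [integral_finsetSum s fun i _ => hi i]
    exact Finset.sum_eq_zero fun i _ => h0 i

lemma integral_abs_le_of_integral_sq_le {Ω : Type*} [MeasurableSpace Ω] {μ : Measure Ω}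
    [IsProbabilityMeasure μ] {Y : Ω → ℝ} (hY : MemLp Y 2 μ) (h : ∫ ω, Y ω ^ 2 ∂μ ≤ 2) :
    ∫ ω, |Y ω| ∂μ ≤ 2 := by
  calc ∫ ω, |Y ω| ∂μ ≤ ∫ ω, (1 + Y ω ^ 2) / 2 ∂μ := by
        refine integral_mono (hY.integrable one_le_two).abs
          (((integrable_const 1).add hY.integrable_sq).div_const 2) fun ω => ?_
        change |Y ω| ≤ (1 + Y ω ^ 2) / 2
        nlinarith [sq_nonneg (|Y ω| - 1), sq_abs (Y ω)]
    _ ≤ 2 := by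
        rw [integral_div, integral_add (integrable_const 1) hY.integrable_sq]
        simp only [integral_const, probReal_univ, smul_eq_mul, mul_one]
        linarith

/-- The truncated linear function behind the concentration inequality: its increments dominate
`min |v| g` on `[a, b]`. -/
lemma abs_mul_min_le_mul_clamp_sub {a b g w v : ℝ} (hg : 0 < g) (hw : w ∈ Set.Icc a b) :
    |v| * min |v| g ≤ v * (max (-((b - a) / 2 + g)) (min ((b - a) / 2 + g) (w - (a + b) / 2)) -
      max (-((b - a) / 2 + g)) (min ((b - a) / 2 + g) (w - v - (a + b) / 2))) := by
  obtain ⟨h1, h2⟩ := hw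
  have e1 : max (-((b - a) / 2 + g)) (min ((b - a) / 2 + g) (w - (a + b) / 2)) =
      w - (a + b) / 2 := by
    rw [min_eq_right (by linarith), max_eq_right (by linarith)]
  rw [e1]
  rcases le_total 0 v with hv | hv
  · rw [abs_of_nonneg hv, min_eq_right (a := (b - a) / 2 + g) (by linarith)]
    refine mul_le_mul_of_nonneg_left ?_ hv
    have := min_le_left v g
    have := min_le_right v g
    rcases max_cases (-((b - a) / 2 + g)) (w - v - (a + b) / 2) with h | h <;> linarith
  · rw [abs_of_nonpos hv, max_eq_right (a := -((b - a) / 2 + g)), neg_mul, ← mul_neg]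
    · refine mul_le_mul_of_nonpos_left ?_ hv
      have := min_le_left (-v) g
      have := min_le_right (-v) g
      rcases min_cases ((b - a) / 2 + g) (w - v - (a + b) / 2) with h | h <;> linarith
    · exact le_min (by linarith) (by linarith)

lemma abs_clamp_le {c : ℝ} (hc : 0 ≤ c) (x : ℝ) : |max (-c) (min c x)| ≤ c :=
  abs_le.2 ⟨le_max_left _ _, max_le (by linarith) (min_le_left _ _)⟩

lemma clamp_mul_sub_nonneg (c w v m : ℝ) :
    0 ≤ v * (max (-c) (min c (w - m)) - max (-c) (min c (w - v - m))) := by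
  rcases le_total 0 v with hv | hv
  · refine mul_nonneg hv (sub_nonneg.2 ?_)
    gcongr; linarith
  · refine mul_nonneg_of_nonpos_of_nonpos hv (sub_nonpos.2 ?_)
    gcongr; linarith

/-- **Concentration inequality** of Chen and Shao for sums of independent centred random
variables. -/
lemma measureReal_sum_mem_Icc_le {ι Ω : Type*} [MeasurableSpace Ω] {μ : Measure Ω}
    [IsProbabilityMeasure μ] {ξ : ι → Ω → ℝ} (s : Finset ι) (hm : ∀ i, Measurable (ξ i))
    (hind : iIndepFun ξ μ) (h3 : ∀ i, MemLp (ξ i) 3 μ) (h0 : ∀ i, ∫ ω, ξ i ω ∂μ = 0)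
    (hv : 1 / 4 ≤ ∑ i ∈ s, ∫ ω, ξ i ω ^ 2 ∂μ) (hv2 : ∑ i ∈ s, ∫ ω, ξ i ω ^ 2 ∂μ ≤ 2)
    {γ : ℝ} (hγ0 : 0 < γ) (hγ : ∑ i ∈ s, ∫ ω, |ξ i ω| ^ 3 ∂μ ≤ γ) {a b : ℝ} (hab : a ≤ b) :
    μ.real {ω | ∑ i ∈ s, ξ i ω ∈ Set.Icc a b} ≤ 8 * (b - a) + 256 * γ := by
  classical
  have h2 : ∀ i, MemLp (ξ i) 2 μ := fun i => (h3 i).mono_exponent (by norm_num)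
  have h1 : ∀ i, Integrable (ξ i) μ := fun i => (h2 i).integrable one_le_two
  -- with this truncation level, `E ∑ |ξ| min(|ξ|, g) ≥ ∑ E ξ² - γ / g ≥ 1 / 8`
  set g : ℝ := 8 * γ with hg
  have hg0 : 0 < g := by positivity
  set c : ℝ := (b - a) / 2 + g with hc
  have hc0 : 0 ≤ c := by rw [hc]; linarith
  set f : ℝ → ℝ := fun w => max (-c) (min c (w - (a + b) / 2)) with hf
  have hfm : Measurable f := by fun_prop
  have hfb : ∀ w, ‖f w‖ ≤ c := fun w => abs_clamp_le hc0 _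
  set W : Ω → ℝ := fun ω => ∑ i ∈ s, ξ i ω with hW
  have hWm : Measurable W := Finset.measurable_sum s fun i _ => hm i
  set A : Set Ω := {ω | W ω ∈ Set.Icc a b} with hA
  have hAm : MeasurableSet A := hWm measurableSet_Icc
  set η : ι → Ω → ℝ := fun i ω => |ξ i ω| * min |ξ i ω| g with hη
  have hηm : ∀ i, Measurable (η i) := fun i => by fun_prop
  have hη0 : ∀ i ω, 0 ≤ η i ω := fun i ω => by positivity
  have hηle : ∀ i ω, ‖η i ω‖ ≤ ‖g * ξ i ω‖ := fun i ω => by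
    rw [Real.norm_of_nonneg (hη0 i ω), norm_mul, Real.norm_of_nonneg hg0.le, Real.norm_eq_abs,
      mul_comm g]
    exact mul_le_mul_of_nonneg_left (min_le_right _ _) (abs_nonneg (ξ i ω))
  have hη2 : ∀ i, MemLp (η i) 2 μ := fun i =>
    ((h2 i).const_mul g).mono (hηm i).aestronglyMeasurable (ae_of_all _ (hηle i))
  have hη1 : ∀ i, Integrable (η i) μ := fun i => (hη2 i).integrable one_le_two
  have hW2 : ∫ ω, W ω ^ 2 ∂μ ≤ 2 := (integral_sq_sum_of_iIndepFun s hind h2 h0).trans_le hv2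
  have hWL : MemLp W 2 μ := memLp_finsetSum s fun i _ => h2 i
  have hW1 : ∫ ω, |W ω| ∂μ ≤ 2 := integral_abs_le_of_integral_sq_le hWL hW2
  -- upper bound for `E [W f(W)]`
  have hup : ∫ ω, W ω * f (W ω) ∂μ ≤ 2 * c := by
    calc ∫ ω, W ω * f (W ω) ∂μ ≤ ∫ ω, |W ω| * c ∂μ := by
          refine integral_mono ((hWL.integrable one_le_two).mul_bdd (c := c)
            (hfm.comp hWm).aestronglyMeasurable (ae_of_all _ fun ω => hfb _))
            ((hWL.integrable one_le_two).abs.mul_const c) fun ω => ?_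
          exact (le_abs_self _).trans (by rw [abs_mul]; gcongr; exact hfb _)
      _ ≤ 2 * c := by rw [integral_mul_const]; gcongr
  have hint : ∀ i, ∀ V : Ω → ℝ, Measurable V → Integrable (fun ω => ξ i ω * f (V ω)) μ :=
    fun i V hV => (h1 i).mul_bdd (c := c) (hfm.comp hV).aestronglyMeasurable
      (ae_of_all _ fun ω => hfb _)
  -- `E [ξ f(W - ξ)] = 0` by independence
  have hzero : ∀ i ∈ s, ∫ ω, ξ i ω * f (W ω - ξ i ω) ∂μ = 0 := by
    intro i hi
    have hI : IndepFun (ξ i) (∑ j ∈ s.erase i, ξ j) μ :=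
      (hind.indepFun_finsetSum_of_notMem hm (Finset.notMem_erase i s)).symm
    have e : ∀ ω, W ω - ξ i ω = (∑ j ∈ s.erase i, ξ j) ω := fun ω => by
      simp only [hW, Finset.sum_apply]
      rw [← Finset.sum_erase_add s (fun j => ξ j ω) hi, add_sub_cancel_right]
    simp_rw [e]
    have hSm : Measurable (∑ j ∈ s.erase i, ξ j) := by fun_prop
    refine (IndepFun.integral_fun_comp_mul_comp (f := id) hI (hm i).aemeasurable
      hSm.aemeasurable measurable_id.aestronglyMeasurable hfm.aestronglyMeasurable).trans ?_
    simp [h0 i]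
  have hlow : ∫ ω, A.indicator (fun ω => ∑ i ∈ s, η i ω) ω ∂μ ≤ ∫ ω, W ω * f (W ω) ∂μ := by
    have hd : ∀ i, Integrable (fun ω => ξ i ω * (f (W ω) - f (W ω - ξ i ω))) μ := fun i => by
      simp_rw [mul_sub]
      exact (hint i W hWm).sub (hint i (fun ω => W ω - ξ i ω) (hWm.sub (hm i)))
    have e : ∫ ω, W ω * f (W ω) ∂μ =
        ∫ ω, ∑ i ∈ s, ξ i ω * (f (W ω) - f (W ω - ξ i ω)) ∂μ := by
      rw [integral_finsetSum s fun i _ => hd i]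
      have e1 : ∀ ω, W ω * f (W ω) = ∑ i ∈ s, ξ i ω * f (W ω) := fun ω => Finset.sum_mul ..
      simp_rw [e1]
      rw [integral_finsetSum s fun i _ => hint i W hWm]
      refine Finset.sum_congr rfl fun i hi => ?_
      simp_rw [mul_sub]
      rw [integral_sub (hint i W hWm) (hint i (fun ω => W ω - ξ i ω) (hWm.sub (hm i))),
        hzero i hi, sub_zero]
    rw [e]
    refine integral_mono ((integrable_finsetSum s fun i _ => hη1 i).indicator hAm)
      (integrable_finsetSum s fun i _ => hd i) fun ω => ?_
    by_cases hω : ω ∈ A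
    · simp only [Set.indicator_of_mem hω]
      exact Finset.sum_le_sum fun i _ => abs_mul_min_le_mul_clamp_sub hg0 hω
    · simp only [Set.indicator_of_notMem hω]
      exact Finset.sum_nonneg fun i _ => clamp_mul_sub_nonneg _ _ _ _
  -- the mean of `∑ η` is at least `1 / 8`; its mean absolute
  -- deviation is at most `2 g`
  set m : ℝ := ∑ i ∈ s, ∫ ω, η i ω ∂μ with hmdef
  have hmean : 1 / 8 ≤ m := by
    have hstep : ∀ i ∈ s, ∫ ω, ξ i ω ^ 2 ∂μ - (∫ ω, |ξ i ω| ^ 3 ∂μ) / g ≤ ∫ ω, η i ω ∂μ := by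
      intro i _
      rw [← integral_div, ← integral_sub (h2 i).integrable_sq
        ((h3 i).integrable_abs_pow_three.div_const g)]
      refine integral_mono ((h2 i).integrable_sq.sub
        ((h3 i).integrable_abs_pow_three.div_const g)) (hη1 i) fun ω => ?_
      change ξ i ω ^ 2 - |ξ i ω| ^ 3 / g ≤ |ξ i ω| * min |ξ i ω| g
      rw [← sq_abs (ξ i ω)]
      have hx := abs_nonneg (ξ i ω)
      generalize |ξ i ω| = x at hx ⊢
      rcases le_total x g with hxg | hxg
      · rw [min_eq_left hxg]
        have : 0 ≤ x ^ 3 / g := by positivity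
        nlinarith
      · rw [min_eq_right hxg]
        have : x ^ 2 ≤ x ^ 3 / g := by
          rw [le_div_iff₀ hg0, pow_succ x 2]; gcongr
        have : 0 ≤ x * g := by positivity
        linarith
    have := Finset.sum_le_sum hstep
    rw [Finset.sum_sub_distrib, ← Finset.sum_div] at this
    have h' : (∑ i ∈ s, ∫ ω, |ξ i ω| ^ 3 ∂μ) / g ≤ 1 / 8 := by
      rw [div_le_iff₀ hg0, hg]; linarith
    linarith
  set H : Ω → ℝ := fun ω => ∑ i ∈ s, η i ω with hH
  have hfluc : ∫ ω, |H ω - m| ∂μ ≤ 2 * g := by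
    have hindη : iIndepFun (fun i ω => η i ω - ∫ ω, η i ω ∂μ) μ :=
      hind.comp (fun i x => |x| * min |x| g - ∫ ω, η i ω ∂μ) fun i => by fun_prop
    have hc2 : ∀ i, MemLp (fun ω => η i ω - ∫ ω, η i ω ∂μ) 2 μ := fun i =>
      (hη2 i).sub (memLp_const _)
    have hsq := integral_sq_sum_of_iIndepFun s hindη hc2 fun i => by
      rw [integral_sub (hη1 i) (integrable_const _)]; simp
    have hle : ∑ i ∈ s, ∫ ω, (η i ω - ∫ ω, η i ω ∂μ) ^ 2 ∂μ ≤ g ^ 2 * 2 := by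
      refine le_trans ?_ (mul_le_mul_of_nonneg_left hv2 (sq_nonneg g))
      rw [Finset.mul_sum]
      refine Finset.sum_le_sum fun i _ => ?_
      rw [← variance_eq_integral (hηm i).aemeasurable]
      refine (variance_le_expectation_sq (hηm i).aestronglyMeasurable).trans ?_
      rw [← integral_const_mul]
      refine integral_mono (hη2 i).integrable_sq ((h2 i).integrable_sq.const_mul _) fun ω => ?_
      change η i ω ^ 2 ≤ g ^ 2 * ξ i ω ^ 2
      rw [← mul_pow]
      exact sq_le_sq.2 (hηle i ω)
    have e : ∀ ω, ∑ i ∈ s, (η i ω - ∫ ω, η i ω ∂μ) = H ω - m := fun ω => by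
      rw [Finset.sum_sub_distrib]
    simp_rw [e] at hsq
    have hL : MemLp (fun ω => H ω - m) 2 μ :=
      (memLp_finsetSum s fun i _ => hη2 i).sub (memLp_const m)
    calc ∫ ω, |H ω - m| ∂μ ≤ ∫ ω, (g + (H ω - m) ^ 2 / g) / 2 ∂μ := by
          refine integral_mono (hL.integrable one_le_two).abs
            (((integrable_const g).add (hL.integrable_sq.div_const g)).div_const 2) fun ω => ?_
          change |H ω - m| ≤ (g + (H ω - m) ^ 2 / g) / 2
          rw [← sq_abs]
          generalize |H ω - m| = x
          have : g + x ^ 2 / g - 2 * x = (g - x) ^ 2 / g := by field_simp; ring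
          have : 0 ≤ (g - x) ^ 2 / g := by positivity
          linarith
      _ = (g + (∫ ω, (H ω - m) ^ 2 ∂μ) / g) / 2 := by
          rw [integral_div, integral_add (integrable_const g) (hL.integrable_sq.div_const g),
            integral_div]
          simp
      _ ≤ 2 * g := by
          have : (∫ ω, (H ω - m) ^ 2 ∂μ) / g ≤ 2 * g := by
            rw [div_le_iff₀ hg0]; linarith
          linarith
  have hHi : Integrable H μ := integrable_finsetSum s fun i _ => hη1 i
  have hAH : m * μ.real A - 2 * g ≤ ∫ ω, A.indicator H ω ∂μ := by
    have h5 : Integrable (fun ω => |H ω - m|) μ := (hHi.sub (integrable_const m)).abs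
    have h4 : ∫ ω, (A.indicator (fun _ => m) ω - |H ω - m|) ∂μ ≤ ∫ ω, A.indicator H ω ∂μ := by
      refine integral_mono (((integrable_const m).indicator hAm).sub h5) (hHi.indicator hAm)
        fun ω => ?_
      by_cases hω : ω ∈ A
      · simp only [Set.indicator_of_mem hω]
        linarith [neg_abs_le (H ω - m)]
      · simp only [Set.indicator_of_notMem hω]
        linarith [abs_nonneg (H ω - m)]
    rw [integral_sub ((integrable_const m).indicator hAm) h5, integral_indicator_const _ hAm,
      smul_eq_mul] at h4
    linarith
  have hP : 0 ≤ μ.real A := measureReal_nonneg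
  have : 1 / 8 * μ.real A ≤ m * μ.real A := by gcongr
  have : c = (b - a) / 2 + 8 * γ := rfl
  change μ.real A ≤ _
  linarith

/-! ### The Berry–Esseen theorem -/

/-- A case of Lyapunov's inequality for moments. -/
lemma integral_sq_mul_integral_abs_le {Ω : Type*} [MeasurableSpace Ω] {μ : Measure Ω}
    [IsProbabilityMeasure μ] {X : Ω → ℝ} (hX : MemLp X 3 μ) :
    (∫ ω, X ω ^ 2 ∂μ) * ∫ ω, |X ω| ∂μ ≤ ∫ ω, |X ω| ^ 3 ∂μ := by
  have h2 : MemLp X 2 μ := hX.mono_exponent (by norm_num)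
  have h1 := (h2.integrable one_le_two).abs
  have h3 := hX.integrable_abs_pow_three
  set p := ∫ ω, |X ω| ∂μ with hp
  have hp0 : 0 ≤ p := integral_nonneg fun ω => abs_nonneg _
  -- tangent-line (Jensen) and Young inequalities, integrated
  have h1p : Integrable (fun ω => 3 * p ^ 2 * (|X ω| - p)) μ :=
    (h1.sub (integrable_const p)).const_mul _
  have hJ : ∫ ω, (p ^ 3 + 3 * p ^ 2 * (|X ω| - p)) ∂μ ≤ ∫ ω, |X ω| ^ 3 ∂μ := by
    refine integral_mono ((integrable_const _).add h1p) h3 fun ω => ?_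
    change p ^ 3 + 3 * p ^ 2 * (|X ω| - p) ≤ |X ω| ^ 3
    have := abs_nonneg (X ω)
    generalize |X ω| = x at this
    nlinarith [mul_nonneg (by linarith : 0 ≤ x + 2 * p) (sq_nonneg (x - p))]
  rw [integral_add (integrable_const _) h1p, integral_const_mul,
    integral_sub h1 (integrable_const p), ← hp] at hJ
  simp only [integral_const, probReal_univ, smul_eq_mul, one_mul, sub_self, mul_zero,
    add_zero] at hJ
  have hY : ∫ ω, X ω ^ 2 * p ∂μ ≤ ∫ ω, (2 / 3 * |X ω| ^ 3 + 1 / 3 * p ^ 3) ∂μ := by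
    refine integral_mono (h2.integrable_sq.mul_const p)
      ((h3.const_mul _).add (integrable_const _)) fun ω => ?_
    change X ω ^ 2 * p ≤ 2 / 3 * |X ω| ^ 3 + 1 / 3 * p ^ 3
    rw [← sq_abs (X ω)]
    have := abs_nonneg (X ω)
    generalize |X ω| = x at this
    nlinarith [mul_nonneg (by linarith : 0 ≤ 2 * x + p) (sq_nonneg (x - p))]
  rw [integral_mul_const, integral_add (h3.const_mul _) (integrable_const _),
    integral_const_mul] at hY
  simp only [integral_const, probReal_univ, smul_eq_mul, one_mul] at hY
  linarith

lemma measurableSet_steinJump (z : ℝ) : MeasurableSet {p : ℝ × ℝ | |p.2 - z| ≤ |p.1|} :=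
  measurableSet_le (by fun_prop) (by fun_prop)

/-- Integrating `steinErr` against two independent variables, the second of which satisfies a
concentration inequality. -/
lemma integral_mul_steinErr_le {Ω : Type*} [MeasurableSpace Ω] {μ : Measure Ω}
    [IsProbabilityMeasure μ] {X Y : Ω → ℝ} (hX : Measurable X) (hY : Measurable Y)
    (hXY : IndepFun X Y μ) (hY2 : MemLp Y 2 μ) (hYv : ∫ ω, Y ω ^ 2 ∂μ ≤ 2) {z γ : ℝ}
    (hconc : ∀ r, 0 ≤ r → μ.real {ω | |Y ω - z| ≤ r} ≤ 16 * r + 256 * γ)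
    {φ : ℝ → ℝ} (hφ : Measurable φ) (hφ0 : ∀ x, 0 ≤ φ x)
    (hφX : Integrable (fun ω => φ (X ω)) μ) (hφX1 : Integrable (fun ω => φ (X ω) * |X ω|) μ) :
    Integrable (fun ω => φ (X ω) * steinErr z (X ω) (Y ω)) μ ∧
      ∫ ω, φ (X ω) * steinErr z (X ω) (Y ω) ∂μ ≤
        73 * ∫ ω, φ (X ω) * |X ω| ∂μ + 1024 * γ * ∫ ω, φ (X ω) ∂μ := by
  set J : Set (ℝ × ℝ) := {p : ℝ × ℝ | |p.2 - z| ≤ |p.1|} with hJ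
  have hJm : MeasurableSet J := measurableSet_steinJump z
  have hY1 : Integrable (fun ω => 1 + |Y ω|) μ :=
    (integrable_const 1).add (hY2.integrable one_le_two).abs
  have hI : IndepFun (fun ω => φ (X ω) * |X ω|) (fun ω => 1 + |Y ω|) μ :=
    hXY.comp (φ := fun x => φ x * |x|) (ψ := fun y => 1 + |y|) (by fun_prop) (by fun_prop)
  have i1 : Integrable (fun ω => φ (X ω) * |X ω| * (1 + |Y ω|)) μ := hI.integrable_mul hφX1 hY1
  have hJ' : Measurable (fun ω => J.indicator (1 : ℝ × ℝ → ℝ) (X ω, Y ω)) :=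
    (measurable_one.indicator hJm).comp (hX.prodMk hY)
  have i2 : Integrable (fun ω => φ (X ω) * J.indicator (1 : ℝ × ℝ → ℝ) (X ω, Y ω)) μ := by
    refine hφX.mul_bdd (c := 1) hJ'.aestronglyMeasurable (ae_of_all _ fun ω => ?_)
    refine (norm_indicator_le_norm_self _ _).trans (by simp)
  have e : ∀ ω, φ (X ω) * steinErr z (X ω) (Y ω) = 3 * (φ (X ω) * |X ω| * (1 + |Y ω|)) +
      4 * (φ (X ω) * J.indicator (1 : ℝ × ℝ → ℝ) (X ω, Y ω)) := fun ω => by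
    rw [steinErr]; ring
  simp_rw [e]
  refine ⟨(i1.const_mul 3).add (i2.const_mul 4), ?_⟩
  rw [integral_add (i1.const_mul 3) (i2.const_mul 4), integral_const_mul, integral_const_mul]
  have b1 : ∫ ω, φ (X ω) * |X ω| * (1 + |Y ω|) ∂μ ≤ (∫ ω, φ (X ω) * |X ω| ∂μ) * 3 := by
    rw [hI.integral_fun_mul_eq_mul_integral hφX1.aestronglyMeasurable hY1.aestronglyMeasurable]
    refine mul_le_mul_of_nonneg_left ?_
      (integral_nonneg fun ω => mul_nonneg (hφ0 _) (abs_nonneg _))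
    rw [integral_add (integrable_const 1) (hY2.integrable one_le_two).abs]
    have := integral_abs_le_of_integral_sq_le hY2 hYv
    simp only [integral_const, probReal_univ, smul_eq_mul, mul_one]
    linarith
  have b2 : ∫ ω, φ (X ω) * J.indicator (1 : ℝ × ℝ → ℝ) (X ω, Y ω) ∂μ ≤
      16 * ∫ ω, φ (X ω) * |X ω| ∂μ + 256 * γ * ∫ ω, φ (X ω) ∂μ := by
    have hp := hXY.map_prod_eq_prod_map_map hX.aemeasurable hY.aemeasurable
    have hpX : IsProbabilityMeasure (μ.map X) := Measure.isProbabilityMeasure_map hX.aemeasurable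
    have hpY : IsProbabilityMeasure (μ.map Y) := Measure.isProbabilityMeasure_map hY.aemeasurable
    have hGm : Measurable (fun p : ℝ × ℝ => φ p.1 * J.indicator (1 : ℝ × ℝ → ℝ) p) :=
      (hφ.comp measurable_fst).mul (measurable_one.indicator hJm)
    have j2 : Integrable (fun p : ℝ × ℝ => φ p.1 * J.indicator (1 : ℝ × ℝ → ℝ) p)
        ((μ.map X).prod (μ.map Y)) := by
      rw [← hp, integrable_map_measure hGm.aestronglyMeasurable (hX.prodMk hY).aemeasurable]
      exact i2
    calc ∫ ω, φ (X ω) * J.indicator (1 : ℝ × ℝ → ℝ) (X ω, Y ω) ∂μ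
        = ∫ p, φ p.1 * J.indicator (1 : ℝ × ℝ → ℝ) p ∂((μ.map X).prod (μ.map Y)) := by
          rw [← hp, integral_map (hX.prodMk hY).aemeasurable hGm.aestronglyMeasurable]
      _ = ∫ x, ∫ y, φ x * J.indicator (1 : ℝ × ℝ → ℝ) (x, y) ∂(μ.map Y) ∂(μ.map X) :=
          integral_prod _ j2
      _ ≤ ∫ x, φ x * (16 * |x| + 256 * γ) ∂(μ.map X) := by
          refine integral_mono_of_nonneg (ae_of_all _ fun x => integral_nonneg fun y =>
            mul_nonneg (hφ0 x) (Set.indicator_nonneg (fun _ _ => zero_le_one) _)) ?_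
            (ae_of_all _ fun x => ?_)
          · rw [integrable_map_measure (by fun_prop) hX.aemeasurable]
            refine ((hφX1.const_mul 16).add (hφX.const_mul (256 * γ))).congr
              (ae_of_all _ fun ω => ?_)
            simp only [Pi.add_apply, Function.comp]; ring
          · change ∫ y, φ x * J.indicator (1 : ℝ × ℝ → ℝ) (x, y) ∂(μ.map Y) ≤ _
            rw [integral_const_mul]
            refine mul_le_mul_of_nonneg_left ?_ (hφ0 x)
            have hset : MeasurableSet {y : ℝ | |y - z| ≤ |x|} :=
              measurableSet_le (by fun_prop) (by fun_prop)
            have : ∀ y, J.indicator (1 : ℝ × ℝ → ℝ) (x, y) =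
                {y : ℝ | |y - z| ≤ |x|}.indicator 1 y := fun y => rfl
            simp_rw [this]
            rw [integral_indicator_one hset, map_measureReal_apply hY hset]
            exact hconc _ (abs_nonneg x)
      _ = ∫ ω, φ (X ω) * (16 * |X ω| + 256 * γ) ∂μ :=
          integral_map hX.aemeasurable (by fun_prop)
      _ = 16 * ∫ ω, φ (X ω) * |X ω| ∂μ + 256 * γ * ∫ ω, φ (X ω) ∂μ := by
          rw [← integral_const_mul, ← integral_const_mul,
            ← integral_add (hφX1.const_mul 16) (hφX.const_mul (256 * γ))]
          congr 1; ext ω; ring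
  linarith

/-- The contribution of one summand `X` to Stein's identity for `Y + X`. -/
lemma abs_stein_term_le {Ω : Type*} [MeasurableSpace Ω] {μ : Measure Ω}
    [IsProbabilityMeasure μ] {X Y : Ω → ℝ} (hX : Measurable X) (hY : Measurable Y)
    (hXY : IndepFun X Y μ) (hX3 : MemLp X 3 μ) (hX0 : ∫ ω, X ω ∂μ = 0) (hY2 : MemLp Y 2 μ)
    (hYv : ∫ ω, Y ω ^ 2 ∂μ ≤ 2) {z γ : ℝ}
    (hconc : ∀ r, 0 ≤ r → μ.real {ω | |Y ω - z| ≤ r} ≤ 16 * r + 256 * γ) :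
    |(∫ ω, X ω ^ 2 ∂μ) * ∫ ω, steinDeriv z (Y ω + X ω) ∂μ -
        ∫ ω, X ω * steinSol z (Y ω + X ω) ∂μ| ≤
      146 * ∫ ω, |X ω| ^ 3 ∂μ + 2048 * γ * ∫ ω, X ω ^ 2 ∂μ := by
  have hX2 : MemLp X 2 μ := hX3.mono_exponent (by norm_num)
  have hX1 : Integrable X μ := hX2.integrable one_le_two
  have hS : Measurable (steinSol z) := (continuous_steinSol z).measurable
  have hD := measurable_steinDeriv z
  have iX3 : Integrable (fun ω => X ω ^ 2 * |X ω|) μ :=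
    hX3.integrable_abs_pow_three.congr (ae_of_all _ fun ω => by
      change |X ω| ^ 3 = X ω ^ 2 * |X ω|
      rw [← sq_abs (X ω)]; ring)
  have eX3 : ∫ ω, X ω ^ 2 * |X ω| ∂μ = ∫ ω, |X ω| ^ 3 ∂μ := by
    congr 1; ext ω; rw [← sq_abs (X ω)]; ring
  obtain ⟨i1, b1⟩ := integral_mul_steinErr_le hX hY hXY hY2 hYv hconc
    (φ := fun _ => 1) measurable_const (fun _ => zero_le_one) (integrable_const 1)
    (by simpa using hX1.abs)
  obtain ⟨i2, b2⟩ := integral_mul_steinErr_le hX hY hXY hY2 hYv hconc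
    (φ := fun x => x ^ 2) (by fun_prop) (fun x => sq_nonneg x) hX2.integrable_sq iX3
  simp only [one_mul, integral_const, probReal_univ, smul_eq_mul, mul_one] at i1 b1
  rw [eX3] at b2
  have iD1 : Integrable (fun ω => steinDeriv z (Y ω + X ω)) μ :=
    Integrable.of_bound (hD.comp (hY.add hX)).aestronglyMeasurable 2
      (ae_of_all _ fun ω => abs_steinDeriv_le z _)
  have iD2 : Integrable (fun ω => steinDeriv z (Y ω)) μ :=
    Integrable.of_bound (hD.comp hY).aestronglyMeasurable 2
      (ae_of_all _ fun ω => abs_steinDeriv_le z _)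
  have iS1 : Integrable (fun ω => X ω * steinSol z (Y ω + X ω)) μ :=
    hX1.mul_bdd (c := 3) (hS.comp (hY.add hX)).aestronglyMeasurable
      (ae_of_all _ fun ω => (steinSol_bounds z _).1)
  have iS2 : Integrable (fun ω => X ω * steinSol z (Y ω)) μ :=
    hX1.mul_bdd (c := 3) (hS.comp hY).aestronglyMeasurable
      (ae_of_all _ fun ω => (steinSol_bounds z _).1)
  have i2D : Integrable (fun ω => X ω ^ 2 * steinDeriv z (Y ω)) μ :=
    hX2.integrable_sq.mul_bdd (c := 2) (hD.comp hY).aestronglyMeasurable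
      (ae_of_all _ fun ω => abs_steinDeriv_le z _)
  have z1 : ∫ ω, X ω * steinSol z (Y ω) ∂μ = 0 := by
    refine (IndepFun.integral_fun_comp_mul_comp (f := id) hXY hX.aemeasurable
      hY.aemeasurable measurable_id.aestronglyMeasurable hS.aestronglyMeasurable).trans ?_
    simp [hX0]
  have z2 : ∫ ω, X ω ^ 2 * steinDeriv z (Y ω) ∂μ =
      (∫ ω, X ω ^ 2 ∂μ) * ∫ ω, steinDeriv z (Y ω) ∂μ :=
    IndepFun.integral_fun_comp_mul_comp (f := fun x => x ^ 2) hXY hX.aemeasurable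
      hY.aemeasurable (by fun_prop) hD.aestronglyMeasurable
  have hv0 : 0 ≤ ∫ ω, X ω ^ 2 ∂μ := integral_nonneg fun ω => sq_nonneg _
  have c1 : |∫ ω, steinDeriv z (Y ω + X ω) ∂μ - ∫ ω, steinDeriv z (Y ω) ∂μ| ≤
      73 * ∫ ω, |X ω| ∂μ + 1024 * γ := by
    rw [← integral_sub iD1 iD2]
    refine (abs_integral_le_integral_abs).trans (le_trans ?_ b1)
    exact integral_mono (iD1.sub iD2).abs i1 fun ω => abs_steinDeriv_add_sub_le z _ _
  have c2 : |∫ ω, X ω ^ 2 * steinDeriv z (Y ω) ∂μ - ∫ ω, X ω * steinSol z (Y ω + X ω) ∂μ| ≤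
      73 * ∫ ω, |X ω| ^ 3 ∂μ + 1024 * γ * ∫ ω, X ω ^ 2 ∂μ := by
    have i12 : Integrable
        (fun ω => X ω * steinSol z (Y ω + X ω) - X ω * steinSol z (Y ω)) μ := iS1.sub iS2
    have : ∫ ω, X ω * steinSol z (Y ω + X ω) ∂μ =
        ∫ ω, (X ω * steinSol z (Y ω + X ω) - X ω * steinSol z (Y ω)) ∂μ := by
      rw [integral_sub iS1 iS2, z1, sub_zero]
    rw [this, ← integral_sub i2D i12]
    refine (abs_integral_le_integral_abs).trans (le_trans ?_ b2)
    refine integral_mono (i2D.sub i12).abs i2 fun ω => ?_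
    change |X ω ^ 2 * steinDeriv z (Y ω) - (X ω * steinSol z (Y ω + X ω) -
      X ω * steinSol z (Y ω))| ≤ X ω ^ 2 * steinErr z (X ω) (Y ω)
    have h := abs_steinSol_add_sub_le z (X ω) (Y ω)
    have e : X ω ^ 2 * steinDeriv z (Y ω) - (X ω * steinSol z (Y ω + X ω) -
      X ω * steinSol z (Y ω)) = -(X ω * (steinSol z (Y ω + X ω) - steinSol z (Y ω) -
        X ω * steinDeriv z (Y ω))) := by ring
    rw [e, abs_neg, abs_mul, ← sq_abs (X ω), sq, mul_assoc]
    exact mul_le_mul_of_nonneg_left h (abs_nonneg _)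
  have c3 : |(∫ ω, X ω ^ 2 ∂μ) *
      (∫ ω, steinDeriv z (Y ω + X ω) ∂μ - ∫ ω, steinDeriv z (Y ω) ∂μ)| ≤
      73 * ∫ ω, |X ω| ^ 3 ∂μ + 1024 * γ * ∫ ω, X ω ^ 2 ∂μ := by
    rw [abs_mul, abs_of_nonneg hv0]
    have := mul_le_mul_of_nonneg_left c1 hv0
    have := integral_sq_mul_integral_abs_le hX3
    linarith
  have := abs_add_le ((∫ ω, X ω ^ 2 ∂μ) *
      (∫ ω, steinDeriv z (Y ω + X ω) ∂μ - ∫ ω, steinDeriv z (Y ω) ∂μ))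
      (∫ ω, X ω ^ 2 * steinDeriv z (Y ω) ∂μ - ∫ ω, X ω * steinSol z (Y ω + X ω) ∂μ)
  have e : (∫ ω, X ω ^ 2 ∂μ) *
      (∫ ω, steinDeriv z (Y ω + X ω) ∂μ - ∫ ω, steinDeriv z (Y ω) ∂μ) +
      (∫ ω, X ω ^ 2 * steinDeriv z (Y ω) ∂μ - ∫ ω, X ω * steinSol z (Y ω + X ω) ∂μ) =
      (∫ ω, X ω ^ 2 ∂μ) * ∫ ω, steinDeriv z (Y ω + X ω) ∂μ -
        ∫ ω, X ω * steinSol z (Y ω + X ω) ∂μ := by rw [z2]; ring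
  rw [e] at this
  linarith

/-- **Berry–Esseen theorem** for sums of independent, not identically distributed variables. The
variance of the sum need only be close to `1`, and no summand may dominate. -/
theorem berryEsseen {ι Ω : Type*} [Fintype ι] [MeasurableSpace Ω] {μ : Measure Ω}
    [IsProbabilityMeasure μ] {ξ : ι → Ω → ℝ} (hm : ∀ i, Measurable (ξ i))
    (hind : iIndepFun ξ μ) (h3 : ∀ i, MemLp (ξ i) 3 μ) (h0 : ∀ i, ∫ ω, ξ i ω ∂μ = 0)
    (hvi : ∀ i, ∫ ω, ξ i ω ^ 2 ∂μ ≤ 1 / 4)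
    (hv : 1 / 2 ≤ ∑ i, ∫ ω, ξ i ω ^ 2 ∂μ) (hv2 : ∑ i, ∫ ω, ξ i ω ^ 2 ∂μ ≤ 2)
    {γ : ℝ} (hγ0 : 0 < γ) (hγ : ∑ i, ∫ ω, |ξ i ω| ^ 3 ∂μ ≤ γ) (z : ℝ) :
    |μ.real {ω | ∑ i, ξ i ω ≤ z} - (1 - gaussianTail z)| ≤
      2 * |1 - ∑ i, ∫ ω, ξ i ω ^ 2 ∂μ| + 5000 * γ := by
  classical
  have h2 : ∀ i, MemLp (ξ i) 2 μ := fun i => (h3 i).mono_exponent (by norm_num)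
  have h1 : ∀ i, Integrable (ξ i) μ := fun i => (h2 i).integrable one_le_two
  set W : Ω → ℝ := fun ω => ∑ i, ξ i ω with hW
  have hWm : Measurable W := by fun_prop
  have hS : Measurable (steinSol z) := (continuous_steinSol z).measurable
  have hD := measurable_steinDeriv z
  have iS : ∀ i, Integrable (fun ω => ξ i ω * steinSol z (W ω)) μ := fun i =>
    (h1 i).mul_bdd (c := 3) (hS.comp hWm).aestronglyMeasurable
      (ae_of_all _ fun ω => (steinSol_bounds z _).1)
  have iWS : Integrable (fun ω => W ω * steinSol z (W ω)) μ :=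
    Integrable.of_bound (hWm.mul (hS.comp hWm)).aestronglyMeasurable 1
      (ae_of_all _ fun ω => (steinSol_bounds z _).2)
  have hAm : MeasurableSet (Set.Iic z) := measurableSet_Iic
  have iI : Integrable (fun ω => (Set.Iic z).indicator (1 : ℝ → ℝ) (W ω)) μ :=
    Integrable.of_bound ((measurable_one.indicator hAm).comp hWm).aestronglyMeasurable 1
      (ae_of_all _ fun ω => (norm_indicator_le_norm_self _ _).trans (by simp))
  -- Stein's equation, integrated
  have hstein : ∫ ω, steinDeriv z (W ω) ∂μ = ∑ i, ∫ ω, ξ i ω * steinSol z (W ω) ∂μ +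
      μ.real {ω | W ω ≤ z} - (1 - gaussianTail z) := by
    have e1 : ∫ ω, (Set.Iic z).indicator (1 : ℝ → ℝ) (W ω) ∂μ = μ.real {ω | W ω ≤ z} := by
      exact integral_indicator_one (μ := μ) (hWm hAm)
    rw [← e1, ← integral_finsetSum _ fun i _ => iS i]
    simp_rw [← Finset.sum_mul]
    have iWI : Integrable
        (fun ω => W ω * steinSol z (W ω) + (Set.Iic z).indicator (1 : ℝ → ℝ) (W ω)) μ := iWS.add iI
    unfold steinDeriv
    rw [integral_sub iWI (integrable_const _), integral_add iWS iI]
    simp [hW]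
  have hterm : ∀ i, |(∫ ω, ξ i ω ^ 2 ∂μ) * ∫ ω, steinDeriv z (W ω) ∂μ -
        ∫ ω, ξ i ω * steinSol z (W ω) ∂μ| ≤
      146 * ∫ ω, |ξ i ω| ^ 3 ∂μ + 2048 * γ * ∫ ω, ξ i ω ^ 2 ∂μ := by
    intro i
    set s := Finset.univ.erase i with hs
    have hI : IndepFun (ξ i) (∑ j ∈ s, ξ j) μ :=
      (hind.indepFun_finsetSum_of_notMem hm (Finset.notMem_erase i _)).symm
    have e : ∀ ω, W ω = (∑ j ∈ s, ξ j) ω + ξ i ω := fun ω => by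
      simp only [hW, Finset.sum_apply]
      rw [hs, Finset.sum_erase_add _ (fun j => ξ j ω) (Finset.mem_univ i)]
    have hvs : ∑ j ∈ s, ∫ ω, ξ j ω ^ 2 ∂μ + ∫ ω, ξ i ω ^ 2 ∂μ = ∑ j, ∫ ω, ξ j ω ^ 2 ∂μ :=
      Finset.sum_erase_add _ _ (Finset.mem_univ i)
    have hi0 : 0 ≤ ∫ ω, ξ i ω ^ 2 ∂μ := integral_nonneg fun ω => sq_nonneg _
    have hγs : ∑ j ∈ s, ∫ ω, |ξ j ω| ^ 3 ∂μ ≤ γ :=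
      (Finset.sum_le_sum_of_subset_of_nonneg (Finset.erase_subset _ _) fun j _ _ =>
        integral_nonneg fun ω => by positivity).trans hγ
    simp_rw [e]
    refine abs_stein_term_le (hm i) (by fun_prop) hI (h3 i) (h0 i)
      (memLp_finsetSum' s fun j _ => h2 j) ?_ ?_
    · simp only [Finset.sum_apply]
      rw [integral_sq_sum_of_iIndepFun s hind h2 h0]
      linarith
    · intro r hr
      have := measureReal_sum_mem_Icc_le s hm hind h3 h0 (by linarith [hvi i]) (by linarith)
        hγ0 hγs (a := z - r) (b := z + r) (by linarith)
      have es : {ω | |(∑ j ∈ s, ξ j) ω - z| ≤ r} =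
          {ω | ∑ j ∈ s, ξ j ω ∈ Set.Icc (z - r) (z + r)} := by
        ext ω
        simp only [Set.mem_ofPred_eq, Set.mem_Icc, Finset.sum_apply, abs_le]
        constructor <;> rintro ⟨h, h'⟩ <;> constructor <;> linarith
      rw [es]
      linarith
  set v := ∑ i, ∫ ω, ξ i ω ^ 2 ∂μ with hvdef
  set d := ∫ ω, steinDeriv z (W ω) ∂μ with hd
  have hdb : |d| ≤ 2 := by
    refine (abs_integral_le_integral_abs).trans ?_
    have := integral_mono (μ := μ) (f := fun ω => |steinDeriv z (W ω)|) (g := fun _ => 2)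
      (Integrable.of_bound (hD.comp hWm).aestronglyMeasurable 2
        (ae_of_all _ fun ω => abs_steinDeriv_le z _)).abs (integrable_const _)
      (fun ω => abs_steinDeriv_le z _)
    simpa using this
  have hsum : |v * d - ∑ i, ∫ ω, ξ i ω * steinSol z (W ω) ∂μ| ≤ 146 * γ + 2048 * γ * v := by
    rw [hvdef, Finset.sum_mul, ← Finset.sum_sub_distrib]
    refine (Finset.abs_sum_le_sum_abs _ _).trans
      ((Finset.sum_le_sum fun i _ => hterm i).trans ?_)
    rw [Finset.sum_add_distrib, ← Finset.mul_sum, ← Finset.mul_sum]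
    linarith
  have e : μ.real {ω | W ω ≤ z} - (1 - gaussianTail z) =
      (1 - v) * d + (v * d - ∑ i, ∫ ω, ξ i ω * steinSol z (W ω) ∂μ) := by
    rw [hstein]; ring
  rw [e]
  refine (abs_add_le _ _).trans ?_
  rw [abs_mul]
  have := mul_le_mul_of_nonneg_left hdb (abs_nonneg (1 - v))
  nlinarith

/-! ### Exponential tilting of a centred law -/

/-- The moments of order at least `2` of the law `ν` grow at most like those of an exponential
variable of scale `h`. -/
def HasFactorialMoments (ν : Measure ℝ) (h : ℝ) : Prop :=
  ∀ j : ℕ, 2 ≤ j → Integrable (fun y => |y| ^ j) ν ∧ ∫ y, |y| ^ j ∂ν ≤ (j.factorial : ℝ) * h ^ j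

lemma abs_exp_sub_sum_le (t : ℝ) (n : ℕ) :
    |Real.exp t - ∑ m ∈ Finset.range n, t ^ m / (m.factorial : ℝ)| ≤ |t| ^ n * Real.exp |t| := by
  have := Complex.norm_exp_sub_sum_le_norm_mul_exp (t : ℂ) n
  rw [Complex.norm_real, Real.norm_eq_abs] at this
  rw [← Real.norm_eq_abs, ← Complex.norm_real]
  push_cast
  exact this

lemma factorial_add_three_le (k : ℕ) :
    ((k + 3).factorial : ℝ) ≤ 48 * 2 ^ k * (k.factorial : ℝ) := by
  have h1 : (k + 3).choose 3 * k.factorial * Nat.factorial 3 = (k + 3).factorial :=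
    Nat.add_choose_mul_factorial_mul_factorial k 3
  have h2 : (k + 3).choose 3 ≤ 2 ^ (k + 3) := Nat.choose_le_two_pow _ _
  have h3 : (k + 3).factorial ≤ 48 * 2 ^ k * k.factorial := by
    rw [← h1, show Nat.factorial 3 = 6 from rfl]
    calc (k + 3).choose 3 * k.factorial * 6 ≤ 2 ^ (k + 3) * k.factorial * 6 := by gcongr
      _ = 48 * 2 ^ k * k.factorial := by ring
  exact_mod_cast h3

/-- The exponentially weighted third moment, expanded as a series of moments. -/
lemma HasFactorialMoments.exp_third_moment {ν : Measure ℝ} {h x : ℝ} (hν : HasFactorialMoments ν h)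
    (hh : 0 < h) (hx : 0 ≤ x) (hxh : x * h ≤ 1 / 4) :
    Integrable (fun y => |y| ^ 3 * Real.exp (x * |y|)) ν ∧
      ∫ y, |y| ^ 3 * Real.exp (x * |y|) ∂ν ≤ 96 * h ^ 3 := by
  have hm : Measurable (fun y : ℝ => |y| ^ 3 * Real.exp (x * |y|)) := by fun_prop
  have h0 : ∀ y : ℝ, 0 ≤ |y| ^ 3 * Real.exp (x * |y|) := fun y => by positivity
  have hser : ∀ y : ℝ, HasSum (fun k : ℕ => x ^ k / (k.factorial : ℝ) * |y| ^ (k + 3))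
      (|y| ^ 3 * Real.exp (x * |y|)) := fun y => by
    have := (NormedSpace.expSeries_div_hasSum_exp (x * |y|)).mul_left (|y| ^ 3)
    rw [← Real.exp_eq_exp_ℝ] at this
    convert! this using 2 with k
    rw [mul_pow, pow_add]; ring
  have hgeo : HasSum (fun k : ℕ => 48 * h ^ 3 * (1 / 2 : ℝ) ^ k) (96 * h ^ 3) := by
    have := hasSum_geometric_two.mul_left (48 * h ^ 3)
    convert! this using 1; ring
  have hl : ∫⁻ y, ENNReal.ofReal (|y| ^ 3 * Real.exp (x * |y|)) ∂ν ≤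
      ENNReal.ofReal (96 * h ^ 3) := by
    have e : ∀ y : ℝ, ENNReal.ofReal (|y| ^ 3 * Real.exp (x * |y|)) =
        ∑' k : ℕ, ENNReal.ofReal (x ^ k / (k.factorial : ℝ) * |y| ^ (k + 3)) := fun y => by
      rw [← (hser y).tsum_eq, ENNReal.ofReal_tsum_of_nonneg (fun k => by positivity)
        (hser y).summable]
    simp_rw [e]
    rw [lintegral_tsum fun k => by fun_prop, ← hgeo.tsum_eq,
      ENNReal.ofReal_tsum_of_nonneg (fun k => by positivity) hgeo.summable]
    refine ENNReal.tsum_le_tsum fun k => ?_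
    obtain ⟨hi, hle⟩ := hν (k + 3) (by omega)
    rw [← ofReal_integral_eq_lintegral_ofReal (hi.const_mul _)
      (ae_of_all _ fun y => by positivity), integral_const_mul]
    apply ENNReal.ofReal_le_ofReal
    have hk : (0 : ℝ) < (k.factorial : ℝ) := by positivity
    calc x ^ k / (k.factorial : ℝ) * ∫ y, |y| ^ (k + 3) ∂ν
        ≤ x ^ k / (k.factorial : ℝ) * ((48 * 2 ^ k * (k.factorial : ℝ)) * h ^ (k + 3)) := by
          refine mul_le_mul_of_nonneg_left (hle.trans ?_) (by positivity)
          exact mul_le_mul_of_nonneg_right (factorial_add_three_le k) (by positivity)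
      _ = 48 * h ^ 3 * (2 * (x * h)) ^ k := by
          rw [mul_pow, mul_pow, pow_add]; field_simp
      _ ≤ 48 * h ^ 3 * (1 / 2 : ℝ) ^ k := by
          gcongr; linarith
  have hi : Integrable (fun y => |y| ^ 3 * Real.exp (x * |y|)) ν := by
    refine ⟨hm.aestronglyMeasurable, ?_⟩
    rw [hasFiniteIntegral_iff_ofReal (ae_of_all _ h0)]
    exact hl.trans_lt ENNReal.ofReal_lt_top
  refine ⟨hi, ?_⟩
  rw [← ofReal_integral_eq_lintegral_ofReal hi (ae_of_all _ h0)] at hl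
  exact (ENNReal.ofReal_le_ofReal_iff (by positivity)).1 hl

/-- Expansions at `0` of the exponential moments `E e^{xY}`, `E Y e^{xY}`, `E Y² e^{xY}` and
`E |Y|³ e^{xY}` of a centred law. -/
lemma HasFactorialMoments.exp_moments {ν : Measure ℝ} [IsProbabilityMeasure ν] {h x : ℝ}
    (hν : HasFactorialMoments ν h) (h0 : ∫ y, y ∂ν = 0)
    (hh : 0 < h) (hx : 0 ≤ x) (hxh : x * h ≤ 1 / 4) :
    (Integrable (fun y => Real.exp (x * y)) ν ∧
      |∫ y, Real.exp (x * y) ∂ν - 1 - x ^ 2 * (∫ y, y ^ 2 ∂ν) / 2| ≤ 96 * x ^ 3 * h ^ 3 ∧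
      1 ≤ ∫ y, Real.exp (x * y) ∂ν) ∧
    (Integrable (fun y => Real.exp (x * y) * y) ν ∧
      |∫ y, Real.exp (x * y) * y ∂ν - x * ∫ y, y ^ 2 ∂ν| ≤ 96 * x ^ 2 * h ^ 3) ∧
    (Integrable (fun y => Real.exp (x * y) * y ^ 2) ν ∧
      |∫ y, Real.exp (x * y) * y ^ 2 ∂ν - ∫ y, y ^ 2 ∂ν| ≤ 96 * x * h ^ 3) ∧
    (Integrable (fun y => Real.exp (x * y) * |y| ^ 3) ν ∧
      ∫ y, Real.exp (x * y) * |y| ^ 3 ∂ν ≤ 96 * h ^ 3) := by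
  obtain ⟨hA, hAle⟩ := hν.exp_third_moment hh hx hxh
  have h2i : Integrable (fun y : ℝ => y ^ 2) ν := by
    simpa only [sq_abs] using (hν 2 le_rfl).1
  have h1i : Integrable (fun y : ℝ => y) ν := by
    refine ((integrable_const (1 : ℝ)).add h2i).mono' (by fun_prop) (ae_of_all _ fun y => ?_)
    change |y| ≤ 1 + y ^ 2
    nlinarith [sq_nonneg (|y| - 1), sq_abs y]
  -- a function dominated by the weighted cube has integral of the corresponding size
  have key : ∀ (g : ℝ → ℝ) (c : ℝ), Measurable g → 0 ≤ c →
      (∀ y, |g y| ≤ c * (|y| ^ 3 * Real.exp (x * |y|))) →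
      Integrable g ν ∧ |∫ y, g y ∂ν| ≤ c * (96 * h ^ 3) := by
    intro g c hg hc hle
    have hi : Integrable g ν := (hA.const_mul c).mono' hg.aestronglyMeasurable (ae_of_all _ hle)
    refine ⟨hi, abs_integral_le_integral_abs.trans
      ((integral_mono hi.abs (hA.const_mul c) hle).trans ?_)⟩
    rw [integral_const_mul]
    gcongr
  have habs : ∀ y : ℝ, |x * y| = x * |y| := fun y => by rw [abs_mul, abs_of_nonneg hx]
  obtain ⟨r0, r0'⟩ := key (fun y => Real.exp (x * y) - (1 + x * y + x ^ 2 / 2 * y ^ 2)) (x ^ 3)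
    (by fun_prop) (by positivity) fun y => by
      have := abs_exp_sub_sum_le (x * y) 3
      simp only [Finset.sum_range_succ, Finset.sum_range_zero, habs] at this
      norm_num [Nat.factorial] at this
      convert! this using 1
      · congr 1; ring
      · ring
  obtain ⟨r1, r1'⟩ := key (fun y => Real.exp (x * y) * y - (y + x * y ^ 2)) (x ^ 2)
    (by fun_prop) (by positivity) fun y => by
      have := abs_exp_sub_sum_le (x * y) 2
      simp only [Finset.sum_range_succ, Finset.sum_range_zero, habs] at this
      norm_num [Nat.factorial] at this
      have e : Real.exp (x * y) * y - (y + x * y ^ 2) = y * (Real.exp (x * y) - (1 + x * y)) := by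
        ring
      rw [e, abs_mul]
      calc |y| * |Real.exp (x * y) - (1 + x * y)|
          ≤ |y| * ((x * |y|) ^ 2 * Real.exp (x * |y|)) := by gcongr
        _ = _ := by ring
  obtain ⟨r2, r2'⟩ := key (fun y => Real.exp (x * y) * y ^ 2 - y ^ 2) x
    (by fun_prop) hx fun y => by
      have := abs_exp_sub_sum_le (x * y) 1
      simp only [Finset.sum_range_succ, Finset.sum_range_zero, habs] at this
      norm_num [Nat.factorial] at this
      have e : Real.exp (x * y) * y ^ 2 - y ^ 2 = |y| ^ 2 * (Real.exp (x * y) - 1) := by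
        rw [sq_abs]; ring
      rw [e, abs_mul, abs_of_nonneg (by positivity : 0 ≤ |y| ^ 2)]
      calc |y| ^ 2 * |Real.exp (x * y) - 1|
          ≤ |y| ^ 2 * (x * |y| * Real.exp (x * |y|)) := by gcongr
        _ = _ := by ring
  obtain ⟨r3, r3'⟩ := key (fun y => Real.exp (x * y) * |y| ^ 3) 1
    (by fun_prop) zero_le_one fun y => by
      rw [abs_of_nonneg (by positivity), one_mul, mul_comm]
      gcongr
      exact le_abs_self y
  have p0 : Integrable (fun y : ℝ => 1 + x * y + x ^ 2 / 2 * y ^ 2) ν :=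
    ((integrable_const 1).add (h1i.const_mul x)).add (h2i.const_mul _)
  have p0' : Integrable (fun y : ℝ => 1 + x * y) ν := (integrable_const 1).add (h1i.const_mul x)
  have p1 : Integrable (fun y : ℝ => y + x * y ^ 2) ν := h1i.add (h2i.const_mul _)
  have i0 : Integrable (fun y => Real.exp (x * y)) ν :=
    (r0.add p0).congr (ae_of_all _ fun y => by simp)
  have i1 : Integrable (fun y => Real.exp (x * y) * y) ν :=
    (r1.add p1).congr (ae_of_all _ fun y => by simp)
  have i2 : Integrable (fun y => Real.exp (x * y) * y ^ 2) ν :=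
    (r2.add h2i).congr (ae_of_all _ fun y => by simp)
  have e0' : ∫ y, (1 + x * y) ∂ν = 1 := by
    rw [integral_add (integrable_const 1) (h1i.const_mul x), integral_const_mul, h0]
    simp
  refine ⟨⟨i0, ?_, ?_⟩, ⟨i1, ?_⟩, ⟨i2, ?_⟩, r3, ?_⟩
  · rw [integral_sub i0 p0, integral_add p0' (h2i.const_mul _), e0', integral_const_mul] at r0'
    convert! r0' using 1
    · congr 1; ring
    · ring
  · rw [← e0']
    refine integral_mono p0' i0 fun y => ?_
    change 1 + x * y ≤ Real.exp (x * y)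
    linarith [Real.add_one_le_exp (x * y)]
  · rw [integral_sub i1 p1, integral_add h1i (h2i.const_mul _), h0, integral_const_mul] at r1'
    convert! r1' using 1
    · congr 1; ring
    · ring
  · rw [integral_sub i2 h2i] at r2'
    convert! r2' using 1
    ring
  · linarith [le_abs_self (∫ y, Real.exp (x * y) * |y| ^ 3 ∂ν)]

/-- The exponential tilt of a centred law `ν` by a small parameter `x`: the cumulant generating
function, and the mean `b`, the variance and the centred third moment under the tilted law. -/
lemma HasFactorialMoments.tilted {ν : Measure ℝ} [IsProbabilityMeasure ν] {h x : ℝ}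
    (hν : HasFactorialMoments ν h) (h0 : ∫ y, y ∂ν = 0)
    (hh : 0 < h) (hx : 0 ≤ x) (hxh : x * h ≤ 1 / 4) :
    Integrable (fun y => Real.exp (x * y)) ν ∧
    |Real.log (∫ y, Real.exp (x * y) ∂ν) - x ^ 2 * (∫ y, y ^ 2 ∂ν) / 2| ≤ 300 * (x * h) ^ 3 ∧
    ∃ b : ℝ, |b - x * ∫ y, y ^ 2 ∂ν| ≤ 110 * x ^ 2 * h ^ 3 ∧
      MemLp (fun y => y - b) 3 (ν.tilted fun y => x * y) ∧
      ∫ y, (y - b) ∂(ν.tilted fun y => x * y) = 0 ∧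
      |∫ y, (y - b) ^ 2 ∂(ν.tilted fun y => x * y) - ∫ y, y ^ 2 ∂ν| ≤ 350 * x * h ^ 3 ∧
      ∫ y, |y - b| ^ 3 ∂(ν.tilted fun y => x * y) ≤ 2500 * h ^ 3 := by
  obtain ⟨⟨i0, m0, hM1⟩, ⟨i1, m1⟩, ⟨i2, m2⟩, ⟨i3, m3⟩⟩ := hν.exp_moments h0 hh hx hxh
  have hw2 : ∫ y, y ^ 2 ∂ν ≤ 2 * h ^ 2 := by
    have := (hν 2 le_rfl).2
    simpa [sq_abs] using this
  have hw0 : 0 ≤ ∫ y, y ^ 2 ∂ν := integral_nonneg fun y => sq_nonneg y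
  have hprob : IsProbabilityMeasure (ν.tilted fun y => x * y) := isProbabilityMeasure_tilted i0
  -- integrals and integrability under the tilted law
  have ht : ∀ g : ℝ → ℝ, ∫ y, g y ∂(ν.tilted fun y => x * y) =
      (∫ y, Real.exp (x * y) * g y ∂ν) / ∫ y, Real.exp (x * y) ∂ν := fun g => by
    rw [integral_tilted, ← integral_div]
    congr 1; ext y; rw [smul_eq_mul]; ring
  have hti : ∀ g : ℝ → ℝ, Integrable (fun y => Real.exp (x * y) * g y) ν →
      Integrable g (ν.tilted fun y => x * y) := fun g hg => by
    rw [integrable_tilted_iff i0]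
    exact hg
  set w := ∫ y, y ^ 2 ∂ν with hwdef
  set M := ∫ y, Real.exp (x * y) ∂ν with hM
  set N1 := ∫ y, Real.exp (x * y) * y ∂ν with hN1
  set N2 := ∫ y, Real.exp (x * y) * y ^ 2 ∂ν with hN2
  set N3 := ∫ y, Real.exp (x * y) * |y| ^ 3 ∂ν with hN3
  have hM0 : 0 < M := by linarith
  set t := x * h with htdef
  have ht0 : 0 ≤ t := by positivity
  have hu : M - 1 ≤ 25 * t ^ 2 := by
    have h1 := (abs_le.1 m0).2
    have h2 : x ^ 2 * w ≤ x ^ 2 * (2 * h ^ 2) := by gcongr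
    have h3 : t ^ 3 ≤ 1 / 4 * t ^ 2 := by
      rw [pow_succ, mul_comm]; gcongr
    have h4 : x ^ 3 * h ^ 3 = t ^ 3 := by rw [htdef]; ring
    have h5 : x ^ 2 * h ^ 2 = t ^ 2 := by rw [htdef]; ring
    linarith
  have hu0 : 0 ≤ M - 1 := by linarith
  set b := N1 / M with hb
  have hbM : b * M = N1 := by rw [hb]; field_simp
  have hb1 : |b - x * w| ≤ 110 * x ^ 2 * h ^ 3 := by
    have e : b - x * w = ((N1 - x * w) - x * w * (M - 1)) / M := by rw [hb]; field_simp; ring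
    rw [e, abs_div, abs_of_pos hM0, div_le_iff₀ hM0]
    have h1 : |x * w * (M - 1)| ≤ 14 * x ^ 2 * h ^ 3 := by
      rw [abs_of_nonneg (by positivity)]
      calc x * w * (M - 1) ≤ x * (2 * h ^ 2) * (25 * t ^ 2) := by gcongr
        _ = 50 * x ^ 2 * h ^ 3 * t := by rw [htdef]; ring
        _ ≤ 50 * x ^ 2 * h ^ 3 * (1 / 4) := by gcongr
        _ ≤ 14 * x ^ 2 * h ^ 3 := by
          have : 0 ≤ x ^ 2 * h ^ 3 := by positivity
          linarith
    have h2 := abs_sub (N1 - x * w) (x * w * (M - 1))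
    have h3 : 0 ≤ 110 * x ^ 2 * h ^ 3 := by positivity
    linarith [le_mul_of_one_le_right h3 hM1]
  have hb2 : |b| ≤ 30 * x * h ^ 2 := by
    have h1 := abs_add_le (b - x * w) (x * w)
    rw [sub_add_cancel, abs_of_nonneg (by positivity : 0 ≤ x * w)] at h1
    have h2 : x * w ≤ x * (2 * h ^ 2) := by gcongr
    have h3 : 110 * x ^ 2 * h ^ 3 = 110 * x * h ^ 2 * t := by rw [htdef]; ring
    have h4 : 110 * x * h ^ 2 * t ≤ 110 * x * h ^ 2 * (1 / 4) := by gcongr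
    have : 0 ≤ x * h ^ 2 := by positivity
    linarith
  have hb3 : |b| ≤ 8 * h := by
    have : 30 * x * h ^ 2 = 30 * h * t := by rw [htdef]; ring
    have : 30 * h * t ≤ 30 * h * (1 / 4) := by gcongr
    linarith
  have j1 := hti (fun y => y) i1
  have j2 := hti (fun y => y ^ 2) i2
  have j3 := hti (fun y => |y| ^ 3) i3
  have e1 : ∫ y, y ∂(ν.tilted fun y => x * y) = b := ht fun y => y
  refine ⟨i0, ?_, b, hb1, ?_, ?_, ?_, ?_⟩
  · -- `u - u² ≤ log (1 + u) ≤ u`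
    have hlog1 : Real.log M ≤ M - 1 := Real.log_le_sub_one_of_pos hM0
    have hlog2 : (M - 1) - (M - 1) ^ 2 ≤ Real.log M := by
      refine le_trans ?_ (Real.one_sub_inv_le_log_of_pos hM0)
      have : 1 - M⁻¹ = (M - 1) / M := by field_simp
      rw [this, le_div_iff₀ hM0]
      linarith [pow_nonneg hu0 3, (by ring : ((M - 1) - (M - 1) ^ 2) * M = (M - 1) - (M - 1) ^ 3)]
    have h1 := abs_le.1 m0
    have h2 : (M - 1) ^ 2 ≤ (25 * t ^ 2) ^ 2 := by gcongr
    have h3 : (25 * t ^ 2) ^ 2 ≤ 625 * t ^ 3 * (1 / 4) := by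
      calc (25 * t ^ 2) ^ 2 = 625 * t ^ 3 * t := by ring
        _ ≤ _ := by gcongr
    have h4 : x ^ 3 * h ^ 3 = t ^ 3 := by rw [htdef]; ring
    have h5 : 0 ≤ t ^ 3 := by positivity
    rw [abs_le]
    constructor <;> linarith
  · have hid : MemLp (fun y : ℝ => y) 3 (ν.tilted fun y => x * y) := by
      rw [← integrable_norm_rpow_iff (by fun_prop) (by norm_num) (by norm_num)]
      refine j3.congr (ae_of_all _ fun y => ?_)
      simp only [ENNReal.toReal_ofNat, Real.norm_eq_abs]
      exact_mod_cast rfl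
    exact hid.sub (memLp_const b)
  · rw [integral_sub j1 (integrable_const b), e1]; simp
  · have k1 : Integrable (fun y => 2 * b * y) (ν.tilted fun y => x * y) := j1.const_mul _
    have k2 : Integrable (fun y => y ^ 2 - 2 * b * y) (ν.tilted fun y => x * y) := j2.sub k1
    have e2 : ∫ y, (y - b) ^ 2 ∂(ν.tilted fun y => x * y) = N2 / M - b ^ 2 := by
      have : ∀ y : ℝ, (y - b) ^ 2 = y ^ 2 - 2 * b * y + b ^ 2 := fun y => by ring
      simp_rw [this]
      rw [integral_add k2 (integrable_const _), integral_sub j2 k1, integral_const_mul, e1, ht]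
      simp only [integral_const, probReal_univ, smul_eq_mul, one_mul]
      ring
    rw [e2]
    have e3 : N2 / M - b ^ 2 - w = ((N2 - w) - w * (M - 1)) / M - b ^ 2 := by field_simp; ring
    rw [e3]
    have h1 : |((N2 - w) - w * (M - 1)) / M| ≤ 110 * x * h ^ 3 := by
      rw [abs_div, abs_of_pos hM0, div_le_iff₀ hM0]
      have h1 : |w * (M - 1)| ≤ 14 * x * h ^ 3 := by
        rw [abs_of_nonneg (by positivity)]
        calc w * (M - 1) ≤ (2 * h ^ 2) * (25 * t ^ 2) := by gcongr
          _ = 50 * x * h ^ 3 * t := by rw [htdef]; ring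
          _ ≤ 50 * x * h ^ 3 * (1 / 4) := by gcongr
          _ ≤ 14 * x * h ^ 3 := by
            have : 0 ≤ x * h ^ 3 := by positivity
            linarith
      have h2 := abs_sub (N2 - w) (w * (M - 1))
      have h3 : 0 ≤ 110 * x * h ^ 3 := by positivity
      linarith [le_mul_of_one_le_right h3 hM1]
    have h2 : b ^ 2 ≤ 225 * x * h ^ 3 := by
      rw [← sq_abs]
      calc |b| ^ 2 ≤ (30 * x * h ^ 2) ^ 2 := by gcongr
        _ = 900 * x * h ^ 3 * t := by rw [htdef]; ring
        _ ≤ 900 * x * h ^ 3 * (1 / 4) := by gcongr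
        _ = _ := by ring
    have h3 := abs_sub (((N2 - w) - w * (M - 1)) / M) (b ^ 2)
    rw [abs_of_nonneg (sq_nonneg b)] at h3
    have : 0 ≤ x * h ^ 3 := by positivity
    linarith
  · have hle : ∀ y : ℝ, |y - b| ^ 3 ≤ 4 * |y| ^ 3 + 4 * |b| ^ 3 := fun y => by
      have h1 : |y - b| ^ 3 ≤ (|y| + |b|) ^ 3 := by gcongr; exact abs_sub _ _
      have hy := abs_nonneg y
      have hb := abs_nonneg b
      nlinarith [mul_nonneg (add_nonneg hy hb) (sq_nonneg (|y| - |b|))]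
    have k : Integrable (fun y => 4 * |y| ^ 3 + 4 * |b| ^ 3) (ν.tilted fun y => x * y) :=
      (j3.const_mul 4).add (integrable_const _)
    refine (integral_mono_of_nonneg (ae_of_all _ fun y => by positivity) k
      (ae_of_all _ hle)).trans ?_
    rw [integral_add (j3.const_mul 4) (integrable_const _), integral_const_mul, ht]
    simp only [integral_const, probReal_univ, smul_eq_mul, one_mul]
    have h1 : N3 / M ≤ 96 * h ^ 3 := by
      rw [div_le_iff₀ hM0]
      have : 0 ≤ 96 * h ^ 3 := by positivity
      linarith [le_mul_of_one_le_right this hM1]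
    have h2 : |b| ^ 3 ≤ (8 * h) ^ 3 := by gcongr
    have h3 : 0 ≤ h ^ 3 := by positivity
    linarith

/-! ### Tilting products of laws and recovering the tail -/

/-- The product of exponentially tilted laws is the exponential tilt of the product law. -/
lemma pi_tilted {ι : Type*} [Fintype ι] (ν : ι → Measure ℝ) [∀ i, IsProbabilityMeasure (ν i)]
    (f : ι → ℝ → ℝ) (hf : ∀ i, Integrable (fun y => Real.exp (f i y)) (ν i)) :
    Measure.pi (fun i => (ν i).tilted (f i)) =
      (Measure.pi ν).tilted fun y => ∑ i, f i (y i) := by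
  classical
  have hprob : ∀ i, IsProbabilityMeasure ((ν i).tilted (f i)) := fun i =>
    isProbabilityMeasure_tilted (hf i)
  refine Measure.pi_eq fun s hs => ?_
  have hsm : MeasurableSet (Set.univ.pi s) := MeasurableSet.univ_pi hs
  have hZ : ∫ y, Real.exp (∑ i, f i (y i)) ∂Measure.pi ν = ∏ i, ∫ y, Real.exp (f i y) ∂ν i := by
    simp_rw [Real.exp_sum]
    exact integral_fintype_prod_eq_prod fun i y => Real.exp (f i y)
  rw [tilted_apply_eq_ofReal_integral' _ hsm, hZ]
  have e : ∀ i, (ν i).tilted (f i) (s i) = ENNReal.ofReal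
      (∫ y, (s i).indicator (fun y => Real.exp (f i y) / ∫ y, Real.exp (f i y) ∂ν i) y ∂ν i) :=
    fun i => by rw [tilted_apply_eq_ofReal_integral' _ (hs i), integral_indicator (hs i)]
  simp_rw [e]
  rw [← ENNReal.ofReal_prod_of_nonneg fun i _ => integral_nonneg fun y =>
    Set.indicator_nonneg (fun _ _ => div_nonneg (Real.exp_pos _).le
      (integral_nonneg fun _ => (Real.exp_pos _).le)) _]
  rw [← integral_fintype_prod_eq_prod (μ := ν) fun i =>
    (s i).indicator fun y => Real.exp (f i y) / ∫ y, Real.exp (f i y) ∂ν i,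
    ← integral_indicator hsm]
  refine congrArg ENNReal.ofReal (integral_congr_ae (ae_of_all _ fun y => ?_))
  beta_reduce
  by_cases hy : y ∈ Set.univ.pi s
  · rw [Set.indicator_of_mem hy, Real.exp_sum, ← Finset.prod_div_distrib]
    exact Finset.prod_congr rfl fun i _ => by rw [Set.indicator_of_mem (hy i (Set.mem_univ i))]
  · rw [Set.indicator_of_notMem hy]
    simp only [Set.mem_pi, Set.mem_univ, true_imp_iff, not_forall] at hy
    obtain ⟨i, hi⟩ := hy
    exact (Finset.prod_eq_zero (Finset.mem_univ i) (Set.indicator_of_notMem hi _)).symm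

/-- The one-sided exponential `y ↦ e^{-xy} 1_{y > 0}`, against which the tilted law of the sum is
integrated to recover the tail of the original law. -/
noncomputable def tailKernel (x y : ℝ) : ℝ := (Set.Ioi 0).indicator (fun y => Real.exp (-x * y)) y

lemma measurable_tailKernel (x : ℝ) : Measurable (tailKernel x) :=
  Measurable.indicator (by fun_prop) measurableSet_Ioi

lemma tailKernel_nonneg (x y : ℝ) : 0 ≤ tailKernel x y :=
  Set.indicator_nonneg (fun _ _ => (Real.exp_pos _).le) y

lemma tailKernel_le_one {x : ℝ} (hx : 0 < x) (y : ℝ) : tailKernel x y ≤ 1 := by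
  refine Set.indicator_le' (fun y (hy : 0 < y) => ?_) (fun _ _ => zero_le_one) y
  rw [Real.exp_le_one_iff]
  nlinarith

lemma setOf_le_tailKernel {x t : ℝ} (hx : 0 < x) (ht : 0 < t) :
    {y | t ≤ tailKernel x y} = Set.Ioc 0 (-Real.log t / x) := by
  ext y
  simp only [Set.mem_ofPred_eq, Set.mem_Ioc, tailKernel]
  by_cases hy : 0 < y
  · rw [Set.indicator_of_mem (show y ∈ Set.Ioi 0 from hy), ← Real.log_le_iff_le_exp ht,
      le_div_iff₀ hx]
    simp only [hy, true_and]
    constructor <;> intro h <;> linarith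
  · rw [Set.indicator_of_notMem (show y ∉ Set.Ioi 0 from hy)]
    simp only [hy, false_and, iff_false, not_le]
    exact ht

/-- A uniform bound on the difference of distribution functions bounds the difference of the
integrals of `tailKernel x`, by the layer-cake formula. -/
lemma abs_integral_tailKernel_sub_le (ρ₁ ρ₂ : Measure ℝ) [IsProbabilityMeasure ρ₁]
    [IsProbabilityMeasure ρ₂] {B x : ℝ} (hx : 0 < x)
    (hB : ∀ z, |ρ₁.real (Set.Iic z) - ρ₂.real (Set.Iic z)| ≤ B) :
    |∫ y, tailKernel x y ∂ρ₁ - ∫ y, tailKernel x y ∂ρ₂| ≤ 2 * B := by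
  have hint : ∀ ρ : Measure ℝ, IsProbabilityMeasure ρ → Integrable (tailKernel x) ρ :=
    fun ρ _ => Integrable.of_bound (measurable_tailKernel x).aestronglyMeasurable 1
      (ae_of_all _ fun y => by
        rw [Real.norm_of_nonneg (tailKernel_nonneg x y)]; exact tailKernel_le_one hx y)
  have hlc : ∀ ρ : Measure ℝ, IsProbabilityMeasure ρ → ∫ y, tailKernel x y ∂ρ =
      ∫ t in Set.Ioc 0 1, ρ.real {y | t ≤ tailKernel x y} := fun ρ hρ =>
    (hint ρ hρ).integral_eq_integral_Ioc_meas_le (ae_of_all _ (tailKernel_nonneg x))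
      (ae_of_all _ (tailKernel_le_one hx))
  have hti : ∀ ρ : Measure ℝ, IsProbabilityMeasure ρ →
      IntegrableOn (fun t => ρ.real {y | t ≤ tailKernel x y}) (Set.Ioc 0 1) := fun ρ _ => by
    have hanti : Antitone (fun t => ρ.real {y | t ≤ tailKernel x y}) := fun s t hst =>
      measureReal_mono fun y (hy : t ≤ _) => hst.trans hy
    exact Integrable.of_bound hanti.measurable.aestronglyMeasurable 1
      (ae_of_all _ fun t => by
        rw [Real.norm_of_nonneg measureReal_nonneg]; exact measureReal_le_one)
  rw [hlc ρ₁ inferInstance, hlc ρ₂ inferInstance,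
    ← integral_sub (hti ρ₁ inferInstance) (hti ρ₂ inferInstance)]
  have := norm_setIntegral_le_of_norm_le_const (μ := volume) (s := Set.Ioc (0 : ℝ) 1) (C := 2 * B)
    (f := fun t => ρ₁.real {y | t ≤ tailKernel x y} - ρ₂.real {y | t ≤ tailKernel x y})
    (by simp) fun t ht => by
      have hc : 0 ≤ -Real.log t / x :=
        div_nonneg (neg_nonneg.2 (Real.log_nonpos ht.1.le ht.2)) hx.le
      have e : ∀ ρ : Measure ℝ, IsProbabilityMeasure ρ → ρ.real (Set.Ioc 0 (-Real.log t / x)) =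
          ρ.real (Set.Iic (-Real.log t / x)) - ρ.real (Set.Iic 0) := fun ρ _ => by
        rw [← Set.Iic_sdiff_Iic, measureReal_sdiff (Set.Iic_subset_Iic.2 hc) measurableSet_Iic]
      rw [setOf_le_tailKernel hx ht.1, e ρ₁ inferInstance, e ρ₂ inferInstance, Real.norm_eq_abs]
      have h1 := abs_le.1 (hB (-Real.log t / x))
      have h2 := abs_le.1 (hB 0)
      rw [abs_le]
      constructor <;> linarith
  simpa using this

/-- The Gaussian integral of `tailKernel x`, by completing the square. -/
lemma integral_tailKernel_gaussianReal (x : ℝ) :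
    ∫ y, tailKernel x y ∂gaussianReal 0 1 = Real.exp (x ^ 2 / 2) * gaussianTail x := by
  rw [integral_gaussianReal_eq_integral_smul one_ne_zero, gaussianTail_eq_integral,
    ← integral_indicator measurableSet_Ioi,
    ← integral_add_right_eq_self ((Set.Ioi x).indicator (gaussianPDFReal 0 1)) x,
    ← integral_const_mul]
  congr 1
  ext y
  by_cases hy : 0 < y
  · rw [tailKernel, Set.indicator_of_mem (show y ∈ Set.Ioi 0 from hy),
      Set.indicator_of_mem (show y + x ∈ Set.Ioi x by simpa using hy), gaussianPDFReal_zero_one,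
      gaussianPDFReal_zero_one, smul_eq_mul, mul_assoc, ← Real.exp_add, mul_left_comm,
      ← Real.exp_add]
    congr 2; ring
  · rw [tailKernel, Set.indicator_of_notMem (show y ∉ Set.Ioi 0 from hy),
      Set.indicator_of_notMem (show y + x ∉ Set.Ioi x by simpa using hy)]
    simp

lemma abs_gaussianTail_sub_le (a b : ℝ) : |gaussianTail a - gaussianTail b| ≤ |b - a| := by
  rw [gaussianTail_sub, ← Real.norm_eq_abs]
  have := intervalIntegral.norm_integral_le_of_norm_le_const (a := a) (b := b) (C := 1)
    (f := gaussianPDFReal 0 1) fun t _ => by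
      rw [Real.norm_of_nonneg (gaussianPDFReal_nonneg _ _ _), gaussianPDFReal_zero_one]
      refine mul_le_one₀ (inv_le_one_of_one_le₀ ?_) (Real.exp_pos _).le ?_
      · rw [Real.one_le_sqrt]; linarith [Real.pi_gt_three]
      · rw [Real.exp_le_one_iff]; nlinarith [sq_nonneg t]
  simpa using this

/-- **Berry–Esseen under the tilt**: if independent centred laws `ν i` have total variance `1`, the
sum under the laws tilted by `x` is close to a Gaussian variable with mean `x` and variance `1`. -/
lemma abs_pi_tilted_sub_le {ι : Type*} [Fintype ι] {ν : ι → Measure ℝ}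
    [∀ i, IsProbabilityMeasure (ν i)] {h x : ℝ} (hν : ∀ i, HasFactorialMoments (ν i) h)
    (h0 : ∀ i, ∫ y, y ∂ν i = 0) (hvar : ∑ i, ∫ y, y ^ 2 ∂ν i = 1) (hh : 0 < h) (hx : 1 ≤ x)
    (hL : 1 / 2 ≤ Fintype.card ι * h ^ 2)
    (hsmall : Fintype.card ι * h ^ 3 * x ^ 3 ≤ 1 / 10 ^ 6) (z : ℝ) :
    |(Measure.pi fun i => (ν i).tilted fun y => x * y).real {y | ∑ i, y i - x ≤ z} -
      (1 - gaussianTail z)| ≤ 13000000 * (Fintype.card ι * h ^ 3) * x ^ 2 := by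
  set n : ℝ := (Fintype.card ι : ℝ) with hn
  set L := n * h ^ 3 with hLdef
  have hn0 : 0 ≤ n := Nat.cast_nonneg _
  have hhL : h ≤ 2 * L := by
    have : 2 * L = 2 * (n * h ^ 2) * h := by rw [hLdef]; ring
    nlinarith
  have hL0 : 0 < L := by linarith
  have hx0 : 0 ≤ x := by linarith
  have hx2 : x ≤ x ^ 2 := by nlinarith
  have hx3 : x ^ 2 ≤ x ^ 3 := by nlinarith [sq_nonneg x]
  have hxL : x * L ≤ 1 / 10 ^ 6 := by nlinarith
  have hxh : x * h ≤ 1 / 4 := by nlinarith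
  have hL1 : L ≤ 1 / 10 ^ 6 := by nlinarith
  choose i0 _ b hb hb3 hb0 hbv hbt using fun i => (hν i).tilted (h0 i) hh hx0 hxh
  have hprob : ∀ i, IsProbabilityMeasure ((ν i).tilted fun y => x * y) := fun i =>
    isProbabilityMeasure_tilted (i0 i)
  set Q := Measure.pi fun i => (ν i).tilted fun y => x * y with hQ
  have hmean : |x - ∑ i, b i| ≤ 110 * x ^ 2 * L := by
    have e : x - ∑ i, b i = -∑ i, (b i - x * ∫ y, y ^ 2 ∂ν i) := by
      rw [Finset.sum_sub_distrib, ← Finset.mul_sum, hvar]; ring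
    rw [e, abs_neg]
    refine (Finset.abs_sum_le_sum_abs _ _).trans ((Finset.sum_le_sum fun i _ => hb i).trans ?_)
    rw [Finset.sum_const, Finset.card_univ, nsmul_eq_mul, ← hn, hLdef]
    exact le_of_eq (by ring)
  have e2 : ∀ i, ∫ y, (y i - b i) ^ 2 ∂Q = ∫ y, (y - b i) ^ 2 ∂(ν i).tilted fun y => x * y :=
    fun i => integral_comp_eval (μ := fun i => (ν i).tilted fun y => x * y)
      (f := fun y => (y - b i) ^ 2) (by fun_prop)
  have e3 : ∀ i, ∫ y, |y i - b i| ^ 3 ∂Q = ∫ y, |y - b i| ^ 3 ∂(ν i).tilted fun y => x * y :=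
    fun i => integral_comp_eval (μ := fun i => (ν i).tilted fun y => x * y)
      (f := fun y => |y - b i| ^ 3) (by fun_prop)
  have e1 : ∀ i, ∫ y, (y i - b i) ∂Q = ∫ y, (y - b i) ∂(ν i).tilted fun y => x * y :=
    fun i => integral_comp_eval (μ := fun i => (ν i).tilted fun y => x * y)
      (f := fun y => y - b i) (by fun_prop)
  have hvarQ : |∑ i, ∫ y, (y i - b i) ^ 2 ∂Q - 1| ≤ 350 * x * L := by
    have e : ∑ i, ∫ y, (y i - b i) ^ 2 ∂Q - 1 =
        ∑ i, (∫ y, (y - b i) ^ 2 ∂((ν i).tilted fun y => x * y) - ∫ y, y ^ 2 ∂ν i) := by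
      rw [Finset.sum_sub_distrib, hvar]
      simp_rw [e2]
    rw [e]
    refine (Finset.abs_sum_le_sum_abs _ _).trans ((Finset.sum_le_sum fun i _ => hbv i).trans ?_)
    rw [Finset.sum_const, Finset.card_univ, nsmul_eq_mul, ← hn, hLdef]
    exact le_of_eq (by ring)
  have hvb := abs_le.1 hvarQ
  have hthird : ∑ i, ∫ y, |y i - b i| ^ 3 ∂Q ≤ 2500 * L := by
    simp_rw [e3]
    refine (Finset.sum_le_sum fun i _ => hbt i).trans ?_
    rw [Finset.sum_const, Finset.card_univ, nsmul_eq_mul, ← hn, hLdef]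
    exact le_of_eq (by ring)
  have hvi : ∀ i, ∫ y, (y i - b i) ^ 2 ∂Q ≤ 1 / 4 := fun i => by
    rw [e2]
    have h1 := (abs_le.1 (hbv i)).2
    have h2 : ∫ y, y ^ 2 ∂ν i ≤ 2 * h ^ 2 := by
      have := (hν i 2 le_rfl).2
      simpa [sq_abs] using this
    have h3 : h ≤ 1 / 1000 := by linarith
    have h4 : h ^ 2 ≤ (1 / 1000) ^ 2 := by gcongr
    have h5 : 350 * x * h ^ 3 = 350 * (x * h) * h ^ 2 := by ring
    have h6 : 350 * (x * h) * h ^ 2 ≤ 350 * (1 / 4) * (1 / 1000) ^ 2 := by gcongr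
    linarith
  have hBE := berryEsseen (μ := Q) (ξ := fun i y => y i - b i) (fun i => by fun_prop)
    (iIndepFun_pi (μ := fun i => (ν i).tilted fun y => x * y) (X := fun i y => y - b i)
      fun i => by fun_prop)
    (fun i => (hb3 i).comp_measurePreserving (measurePreserving_eval _ i))
    (fun i => (e1 i).trans (hb0 i)) hvi (by linarith) (by linarith)
    (γ := 2500 * L) (by positivity) hthird (z + (x - ∑ i, b i))
  have hset : {y : ι → ℝ | ∑ i, (y i - b i) ≤ z + (x - ∑ i, b i)} =
      {y | ∑ i, y i - x ≤ z} := by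
    ext y
    simp only [Set.mem_ofPred_eq, Finset.sum_sub_distrib]
    constructor <;> intro h <;> linarith
  rw [hset, abs_sub_comm 1] at hBE
  have hT := abs_gaussianTail_sub_le z (z + (x - ∑ i, b i))
  rw [add_sub_cancel_left] at hT
  have hBE' := abs_le.1 hBE
  have hT' := abs_le.1 (hT.trans hmean)
  have hxL2 : x * L ≤ x ^ 2 * L := by gcongr
  have hLL : L ≤ x ^ 2 * L := by nlinarith
  rw [abs_le]
  constructor <;> linarith

/-- A non-asymptotic Cramér-type moderate deviation estimate for the product of centred laws. -/
theorem abs_pi_tail_sub_le {ι : Type*} [Fintype ι] {ν : ι → Measure ℝ}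
    [∀ i, IsProbabilityMeasure (ν i)] {h x : ℝ} (hν : ∀ i, HasFactorialMoments (ν i) h)
    (h0 : ∀ i, ∫ y, y ∂ν i = 0) (hvar : ∑ i, ∫ y, y ^ 2 ∂ν i = 1) (hh : 0 < h) (hx : 1 ≤ x)
    (hsmall : Fintype.card ι * h ^ 3 * x ^ 3 ≤ 1 / 10 ^ 6) :
    |(Measure.pi ν).real {y | x < ∑ i, y i} - gaussianTail x| ≤
      2000000000 * (Fintype.card ι * h ^ 3 * x ^ 3) * gaussianTail x := by
  set n : ℝ := (Fintype.card ι : ℝ) with hn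
  set L := n * h ^ 3 with hLdef
  have hn0 : 0 ≤ n := Nat.cast_nonneg _
  have hnh : 1 / 2 ≤ n * h ^ 2 := by
    have : ∑ i, ∫ y, y ^ 2 ∂ν i ≤ ∑ i : ι, 2 * h ^ 2 := Finset.sum_le_sum fun i _ => by
      have := (hν i 2 le_rfl).2
      simpa [sq_abs] using this
    rw [hvar, Finset.sum_const, Finset.card_univ, nsmul_eq_mul, ← hn] at this
    linarith
  have hBE := abs_pi_tilted_sub_le hν h0 hvar hh hx hnh hsmall
  have hx0 : 0 < x := by linarith
  have hL0 : 0 ≤ L := by positivity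
  have hxh : x * h ≤ 1 / 4 := by
    have h1 : h ≤ 2 * L := by
      have : 2 * L = 2 * (n * h ^ 2) * h := by rw [hLdef]; ring
      nlinarith
    have h2 : x ≤ x ^ 3 := le_self_pow₀ hx (by norm_num)
    have h3 : x * h ≤ x ^ 3 * (2 * L) := by gcongr
    linarith
  have hcum := fun i => (hν i).tilted (h0 i) hh hx0.le hxh
  have hprob : ∀ i, IsProbabilityMeasure ((ν i).tilted fun y => x * y) := fun i =>
    isProbabilityMeasure_tilted (hcum i).1
  have hpt : Measure.pi (fun i => (ν i).tilted fun y => x * y) =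
      (Measure.pi ν).tilted fun y => ∑ i, x * y i := pi_tilted ν _ fun i => (hcum i).1
  set Q := Measure.pi fun i => (ν i).tilted fun y => x * y with hQ
  set Z : ℝ := ∫ y, Real.exp (∑ i, x * y i) ∂Measure.pi ν with hZ
  have hZprod : Z = ∏ i, ∫ y, Real.exp (x * y) ∂ν i := by
    rw [hZ]
    simp_rw [Real.exp_sum]
    exact integral_fintype_prod_eq_prod fun i y => Real.exp (x * y)
  have hMpos : ∀ i, 0 < ∫ y, Real.exp (x * y) ∂ν i := fun i => integral_exp_pos (hcum i).1
  have hZ0 : 0 < Z := by rw [hZprod]; exact Finset.prod_pos fun i _ => hMpos i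
  set θ := Real.log Z - x ^ 2 / 2 with hθ
  have hθb : |θ| ≤ 300 * (L * x ^ 3) := by
    have e : θ = ∑ i, (Real.log (∫ y, Real.exp (x * y) ∂ν i) - x ^ 2 * (∫ y, y ^ 2 ∂ν i) / 2) := by
      rw [hθ, hZprod, Real.log_prod fun i _ => (hMpos i).ne', Finset.sum_sub_distrib,
        ← Finset.sum_div, ← Finset.mul_sum, hvar, mul_one]
    rw [e]
    refine (Finset.abs_sum_le_sum_abs _ _).trans
      ((Finset.sum_le_sum fun i _ => (hcum i).2.1).trans ?_)
    rw [Finset.sum_const, Finset.card_univ, nsmul_eq_mul, ← hn, hLdef]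
    exact le_of_eq (by ring)
  have hZθ : Z = Real.exp θ * Real.exp (x ^ 2 / 2) := by
    rw [← Real.exp_add, hθ, sub_add_cancel, Real.exp_log hZ0]
  -- the law of the recentred sum under the tilt
  have hVm : Measurable fun y : ι → ℝ => ∑ i, y i - x := by fun_prop
  set ρ := Q.map fun y => ∑ i, y i - x with hρ
  have hρp : IsProbabilityMeasure ρ := Measure.isProbabilityMeasure_map hVm.aemeasurable
  set I := ∫ y, tailKernel x y ∂ρ with hI
  have hA : MeasurableSet {y : ι → ℝ | x < ∑ i, y i} :=
    measurableSet_lt measurable_const (by fun_prop)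
  have hP : (Measure.pi ν).real {y | x < ∑ i, y i} = Z * Real.exp (-x ^ 2) * I := by
    rw [hI, hρ, integral_map hVm.aemeasurable (measurable_tailKernel x).aestronglyMeasurable,
      hpt, integral_tilted, ← integral_indicator_one hA, ← integral_const_mul]
    congr 1
    ext y
    rw [smul_eq_mul, ← hZ]
    by_cases hy : x < ∑ i, y i
    · rw [Set.indicator_of_mem (show y ∈ {y : ι → ℝ | x < ∑ i, y i} from hy), tailKernel,
        Set.indicator_of_mem (show ∑ i, y i - x ∈ Set.Ioi 0 from sub_pos.2 hy), Pi.one_apply]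
      have e : Z * Real.exp (-x ^ 2) * (Real.exp (∑ i, x * y i) / Z *
          Real.exp (-x * (∑ i, y i - x))) = Z / Z * (Real.exp (-x ^ 2) *
          (Real.exp (∑ i, x * y i) * Real.exp (-x * (∑ i, y i - x)))) := by ring
      rw [e, div_self hZ0.ne', ← Real.exp_add, ← Real.exp_add, ← Finset.mul_sum, one_mul,
        eq_comm, Real.exp_eq_one_iff]
      ring
    · rw [Set.indicator_of_notMem (show y ∉ {y : ι → ℝ | x < ∑ i, y i} from hy), tailKernel,
        Set.indicator_of_notMem (show ∑ i, y i - x ∉ Set.Ioi 0 from fun h => hy (sub_pos.1 h))]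
      simp
  set G := Real.exp (x ^ 2 / 2) * gaussianTail x with hG
  have hIG : |I - G| ≤ 2 * (13000000 * L * x ^ 2) := by
    rw [hG, ← integral_tailKernel_gaussianReal]
    refine abs_integral_tailKernel_sub_le ρ (gaussianReal 0 1) hx0 fun z => ?_
    rw [gaussianReal_real_Iic_eq, hρ, map_measureReal_apply hVm measurableSet_Iic]
    exact hBE z
  have hGlow : 1 ≤ 20 * x * G := by
    have := le_mul_gaussianTail hx
    rw [div_le_iff₀ (by positivity)] at this
    linarith
  have hG0 : 0 ≤ G := mul_nonneg (Real.exp_pos _).le (gaussianTail_nonneg x)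
  set ε := L * x ^ 3 with hε
  have hε0 : 0 ≤ ε := by positivity
  have hIG' : |I - G| ≤ 520000000 * ε * G := by
    refine hIG.trans ?_
    have := mul_le_mul_of_nonneg_left hGlow (by positivity : 0 ≤ 2 * (13000000 * L * x ^ 2))
    calc 2 * (13000000 * L * x ^ 2) = 2 * (13000000 * L * x ^ 2) * 1 := by ring
      _ ≤ 2 * (13000000 * L * x ^ 2) * (20 * x * G) := this
      _ = 520000000 * ε * G := by rw [hε]; ring
  have hθ1 : |θ| ≤ 1 := by linarith
  have hexp : |Real.exp θ - 1| ≤ 600 * ε := by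
    have := Real.abs_exp_sub_one_le hθ1
    linarith
  have hexp2 : Real.exp θ ≤ 2 := by
    have := (abs_le.1 hexp).2
    linarith
  have e2 : gaussianTail x = Real.exp (-x ^ 2 / 2) * G := by
    rw [hG, ← mul_assoc, ← Real.exp_add]
    ring_nf
    simp
  have hPθ : (Measure.pi ν).real {y | x < ∑ i, y i} - gaussianTail x =
      Real.exp (-x ^ 2 / 2) * (Real.exp θ * (I - G) + (Real.exp θ - 1) * G) := by
    have e1 : Real.exp (x ^ 2 / 2) * Real.exp (-x ^ 2) = Real.exp (-x ^ 2 / 2) := by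
      rw [← Real.exp_add]; congr 1; ring
    rw [hP, hZθ, e2, ← e1]
    ring
  rw [hPθ, abs_mul, abs_of_pos (Real.exp_pos _)]
  have hfin : |Real.exp θ * (I - G) + (Real.exp θ - 1) * G| ≤ 2000000000 * ε * G := by
    refine (abs_add_le _ _).trans ?_
    rw [abs_mul, abs_mul, abs_of_pos (Real.exp_pos _), abs_of_nonneg hG0]
    have h1 : Real.exp θ * |I - G| ≤ 2 * (520000000 * ε * G) := by gcongr
    have h2 : |Real.exp θ - 1| * G ≤ 600 * ε * G := by gcongr
    have : 0 ≤ ε * G := by positivity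
    linarith
  calc Real.exp (-x ^ 2 / 2) * |Real.exp θ * (I - G) + (Real.exp θ - 1) * G|
      ≤ Real.exp (-x ^ 2 / 2) * (2000000000 * ε * G) := by gcongr
    _ = 2000000000 * ε * gaussianTail x := by rw [e2]; ring

lemma gaussianTail_pos (x : ℝ) : 0 < gaussianTail x := by
  have h1 := le_mul_gaussianTail (x := max x 1) (le_max_right _ _)
  have h2 : 0 < 1 / (20 * max x 1) := by
    have : (0 : ℝ) < max x 1 := lt_max_of_lt_right one_pos
    positivity
  exact (pos_of_mul_pos_right (h2.trans_le h1) (Real.exp_pos _).le).trans_le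
    (gaussianTail_antitone (le_max_left _ _))

/-! ### Moderate deviations of normalised row sums -/

/-- A non-asymptotic moderate deviation estimate for the normalised sum of one row. The normalised
summands have factorial moments at scale `h = (C σ)^{1+δ} / (σ √m)`, and `m h³` is
`C^{3(1+δ)} σ^{3δ} / √m`. -/
theorem abs_sumCDF_sub_le {δ C : ℝ} (hC : 1 ≤ C) {Ω : Type*} [MeasurableSpace Ω]
    {P : Measure Ω} [IsProbabilityMeasure P] {m : ℕ} (hm1 : 1 ≤ m) {X : Fin m → Ω → ℝ}
    (hX : ∀ i, Measurable (X i)) (hind : iIndepFun X P) (hX0 : ∀ i, ∫ ω, X i ω ∂P = 0)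
    (hσ : 1 ≤ avgSigma P X)
    (hmom : ∀ i, ∀ j : ℕ, 2 ≤ j → Integrable (fun ω => |X i ω| ^ j) P ∧
      ∫ ω, |X i ω| ^ j ∂P ≤ (j.factorial : ℝ) * (C * avgSigma P X) ^ ((1 + δ) * (j : ℝ)))
    {x : ℝ} (hx : 1 ≤ x)
    (hsmall : C ^ (3 * (1 + δ)) * (avgSigma P X ^ (3 * δ) * (x ^ 3 / √(m : ℝ))) ≤ 1 / 10 ^ 6) :
    |1 - sumCDF P X x - (1 - stdGaussianCDF x)| ≤
      2000000000 * C ^ (3 * (1 + δ)) * (avgSigma P X ^ (3 * δ) * (x ^ 3 / √(m : ℝ))) *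
        (1 - stdGaussianCDF x) := by
  set σ := avgSigma P X with hσdef
  have hσ0 : 0 < σ := by linarith
  have hC0 : 0 < C := by linarith
  have hm0 : (0 : ℝ) < m := by exact_mod_cast hm1
  set s := σ * √(m : ℝ) with hs
  have hsm : 0 < √(m : ℝ) := Real.sqrt_pos.2 hm0
  have hs0 : 0 < s := by positivity
  set H := (C * σ) ^ (1 + δ) with hH
  have hH0 : 0 < H := by positivity
  have hYm : ∀ i, Measurable fun ω => X i ω / s := fun i => (hX i).div_const s
  set ν : Fin m → Measure ℝ := fun i => P.map fun ω => X i ω / s with hν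
  have hprob : ∀ i, IsProbabilityMeasure (ν i) := fun i =>
    Measure.isProbabilityMeasure_map (hYm i).aemeasurable
  have hfm : ∀ i, HasFactorialMoments (ν i) (H / s) := fun i j hj => by
    obtain ⟨h1, h2⟩ := hmom i j hj
    have e : ∀ ω, |X i ω / s| ^ j = |X i ω| ^ j / s ^ j := fun ω => by
      rw [abs_div, abs_of_pos hs0, div_pow]
    constructor
    · rw [integrable_map_measure (by fun_prop) (hYm i).aemeasurable]
      exact (h1.div_const (s ^ j)).congr (ae_of_all _ fun ω => (e ω).symm)
    · rw [integral_map (hYm i).aemeasurable (by fun_prop)]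
      simp_rw [e]
      rw [integral_div, div_pow, ← mul_div_assoc]
      refine div_le_div_of_nonneg_right (h2.trans_eq ?_) (by positivity)
      rw [hH, Real.rpow_mul (by positivity), Real.rpow_natCast]
  have h0 : ∀ i, ∫ y, y ∂ν i = 0 := fun i => by
    rw [integral_map (f := fun y => y) (hYm i).aemeasurable (by fun_prop), integral_div, hX0,
      zero_div]
  have hvar : ∑ i, ∫ y, y ^ 2 ∂ν i = 1 := by
    have e : ∀ i, ∫ y, y ^ 2 ∂ν i = variance (X i) P / s ^ 2 := fun i => by
      rw [integral_map (hYm i).aemeasurable (by fun_prop),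
        variance_of_integral_eq_zero (hX i).aemeasurable (hX0 i), ← integral_div]
      simp_rw [div_pow]
    have hsum0 : 0 ≤ (∑ i, variance (X i) P) / (m : ℝ) :=
      div_nonneg (Finset.sum_nonneg fun i _ => variance_nonneg _ _) hm0.le
    have hσ2 : σ ^ 2 = (∑ i, variance (X i) P) / (m : ℝ) := Real.sq_sqrt hsum0
    simp_rw [e]
    rw [← Finset.sum_div, hs, mul_pow, hσ2, Real.sq_sqrt hm0.le, div_mul_cancel₀ _ hm0.ne',
      div_self]
    intro h
    rw [h, zero_div] at hσ2
    nlinarith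
  have hmh : (Fintype.card (Fin m) : ℝ) * (H / s) ^ 3 * x ^ 3 =
      C ^ (3 * (1 + δ)) * (σ ^ (3 * δ) * (x ^ 3 / √(m : ℝ))) := by
    have e1 : H ^ 3 = C ^ (3 * (1 + δ)) * (σ ^ (3 * δ) * σ ^ 3) := by
      rw [hH, ← Real.rpow_natCast, ← Real.rpow_mul (by positivity), ← Real.rpow_natCast σ 3,
        ← Real.rpow_add hσ0, Real.mul_rpow hC0.le hσ0.le]
      push_cast
      congr 2 <;> ring
    have e2 : s ^ 3 = σ ^ 3 * (m * √(m : ℝ)) := by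
      rw [hs, mul_pow]
      nth_rw 2 [← Real.sq_sqrt hm0.le]
      ring
    rw [Fintype.card_fin, div_pow, e1, e2]
    field_simp
  have key := abs_pi_tail_sub_le hfm h0 hvar (by positivity) hx (hmh.trans_le hsmall)
  have hNm : Measurable (normalizedSum P X) := by
    unfold normalizedSum
    fun_prop
  have hNp : IsProbabilityMeasure (P.map (normalizedSum P X)) :=
    Measure.isProbabilityMeasure_map hNm.aemeasurable
  have hYind : iIndepFun (fun i ω => X i ω / s) P :=
    hind.comp (fun _ y => y / s) fun _ => by fun_prop
  have hA : MeasurableSet {y : Fin m → ℝ | x < ∑ i, y i} :=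
    measurableSet_lt measurable_const (by fun_prop)
  have hcdf : 1 - sumCDF P X x = (Measure.pi ν).real {y | x < ∑ i, y i} := by
    rw [sumCDF, cdf_eq_real, ← probReal_compl_eq_one_sub measurableSet_Iic, Set.compl_Iic,
      map_measureReal_apply hNm measurableSet_Ioi, hν,
      ← hYind.map_fun_eq_pi_map fun i => (hYm i).aemeasurable,
      map_measureReal_apply (by fun_prop) hA]
    congr 1
    ext ω
    simp only [Set.mem_preimage, Set.mem_Ioi, Set.mem_ofPred_eq, normalizedSum, ← Finset.sum_div,
      hs, hσdef]
  rw [hcdf, stdGaussianCDF_eq, sub_sub_cancel]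
  rw [hmh] at key
  linarith

theorem theorem3p1 (δ C : ℝ) (hδ0 : 0 ≤ δ) (hδ1 : δ < 1) (hC : 1 ≤ C) :
    ∃ K : ℝ, 0 < K ∧
      ∀ (Ω : ℕ → Type*) [∀ m, MeasurableSpace (Ω m)]
        (P : ∀ m, Measure (Ω m)) [∀ m, IsProbabilityMeasure (P m)]
        (X : ∀ m, Fin m → Ω m → ℝ),
        (∀ m, 1 ≤ m → ∀ i, Measurable (X m i)) →
        (∀ m, 1 ≤ m → iIndepFun (X m) (P m)) →
        (∀ m, 1 ≤ m → ∀ i, MemLp (X m i) 2 (P m)) →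
        (∀ m, 1 ≤ m → ∀ i, ∫ ω, X m i ω ∂(P m) = 0) →
        (∀ m, 1 ≤ m → 1 ≤ avgSigma (P m) (X m)) →
        (∀ m, 1 ≤ m → ∀ i, ∀ j : ℕ, 2 ≤ j →
          Integrable (fun ω => |X m i ω| ^ j) (P m) ∧
          ∫ ω, |X m i ω| ^ j ∂(P m) ≤
            (j.factorial : ℝ) * (C * avgSigma (P m) (X m)) ^ ((1 + δ) * (j : ℝ))) →
        (fun m : ℕ => avgSigma (P m) (X m) ^ δ) =o[atTop]
          (fun m : ℕ => (m : ℝ) ^ (1 / 6 : ℝ)) →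
        ∀ x : ℕ → ℝ,
          Tendsto x atTop atTop →
          x =o[atTop] (fun m : ℕ => (m : ℝ) ^ (1 / 6 : ℝ) / avgSigma (P m) (X m) ^ δ) →
          ∀ᶠ m : ℕ in atTop, ∃ r : ℝ,
            |r| ≤ K * (avgSigma (P m) (X m) ^ (3 * δ) * (x m ^ 3 / Real.sqrt (m : ℝ))) ∧
            1 - sumCDF (P m) (X m) (x m) = (1 + r) * (1 - stdGaussianCDF (x m)) := by

  have hC0 : 0 < C := by linarith
  refine ⟨2000000000 * C ^ (3 * (1 + δ)), by positivity, ?_⟩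
  intro Ω _ P _ X hX hind _ hX0 hσ hmom _ x hx hxo
  -- `ε` is chosen so that `C^{3(1+δ)} ε³ = 10⁻⁶`
  have hε : 0 < 1 / (100 * C ^ (1 + δ)) := by positivity
  filter_upwards [eventually_ge_atTop 1, hx.eventually_ge_atTop 1, hxo.bound hε] with m hm hxm hb
  have hσ0 : 0 < avgSigma (P m) (X m) := by linarith [hσ m hm]
  have hm0 : (0 : ℝ) < m := by exact_mod_cast hm
  set σ := avgSigma (P m) (X m) with hσdef
  have hsmall : C ^ (3 * (1 + δ)) * (σ ^ (3 * δ) * (x m ^ 3 / √(m : ℝ))) ≤ 1 / 10 ^ 6 := by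
    rw [Real.norm_of_nonneg (by linarith), Real.norm_of_nonneg (by positivity)] at hb
    have h3 : x m ^ 3 ≤ (1 / (100 * C ^ (1 + δ)) * ((m : ℝ) ^ (1 / 6 : ℝ) / σ ^ δ)) ^ 3 := by
      gcongr
    have e1 : ((m : ℝ) ^ (1 / 6 : ℝ)) ^ 3 = √(m : ℝ) := by
      rw [← Real.rpow_natCast, ← Real.rpow_mul hm0.le, Real.sqrt_eq_rpow]; norm_num
    have e2 : (σ ^ δ) ^ 3 = σ ^ (3 * δ) := by
      rw [← Real.rpow_natCast, ← Real.rpow_mul hσ0.le, mul_comm]; norm_num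
    have e3 : (C ^ (1 + δ)) ^ 3 = C ^ (3 * (1 + δ)) := by
      rw [← Real.rpow_natCast, ← Real.rpow_mul hC0.le, mul_comm]; norm_num
    rw [mul_pow, div_pow, div_pow, mul_pow, e1, e2, e3, one_pow] at h3
    have hσδ : 0 < σ ^ (3 * δ) := by positivity
    have hCδ : 0 < C ^ (3 * (1 + δ)) := by positivity
    have hsm : 0 < √(m : ℝ) := Real.sqrt_pos.2 hm0
    calc C ^ (3 * (1 + δ)) * (σ ^ (3 * δ) * (x m ^ 3 / √(m : ℝ)))
        ≤ C ^ (3 * (1 + δ)) * (σ ^ (3 * δ) *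
          ((1 / (100 ^ 3 * C ^ (3 * (1 + δ))) * (√(m : ℝ) / σ ^ (3 * δ))) / √(m : ℝ))) := by gcongr
      _ = 1 / 10 ^ 6 := by field_simp; norm_num
  have key := abs_sumCDF_sub_le hC hm (hX m hm) (hind m hm) (hX0 m hm) (hσ m hm) (hmom m hm)
    hxm hsmall
  have hT : 0 < 1 - stdGaussianCDF (x m) := by
    rw [stdGaussianCDF_eq, sub_sub_cancel]; exact gaussianTail_pos _
  refine ⟨(1 - sumCDF (P m) (X m) (x m) - (1 - stdGaussianCDF (x m))) /
    (1 - stdGaussianCDF (x m)), ?_, ?_⟩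
  · rw [abs_div, abs_of_pos hT, div_le_iff₀ hT]
    exact key
  · field_simp
    ring
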